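/- **Corollary (PCA performance).** Fix an integer $T\ge 1$ and constants $\delta,c_1\in(0,\infty)$. For each $N$ let $\sigma_N>0$, with $\frac{N}{T\sigma_N^2}\to c_1$ as $N\to\infty$, let $\beta=\beta_N\in\mathbb R^N$ be a unit vector, and put $z=z_N=1_N/\sqrt N$ (where $1_N$ is the vector of ones), $\gamma_{x,y}=x^\top y$ and $$\Sigma=\Sigma_N=\sigma_N^2\beta\beta^\top+\delta^2 I .$$ Assume that $\gamma_{\beta,z}$ is bounded away from $0$ and from $1$: there are $0<a$ and $b<1$ with $a\le\gamma_{\beta,z}\le b$ for all large $N$. On one probability space let, for each $N$, $R_1,\dots,R_T$ (depending on $N$) be i.i.d. with law $\mathcal N(0,\Sigma_N)$, and let $f_1,\dots,f_T$ be i.i.d. standard normal variables, not depending on $N$, such that almost surely $\beta_N^\top R_t/\sigma_N\to f_t$ as $N\to\infty$ for each $t$ (this holds for instance in the one-factor model $R_t=\phi_t\beta+\epsilon_t$ with $\phi_t=\sigma_N f_t$ and $\epsilon_t\sim\mathcal N(0,\delta^2 I)$ independent of the $f_t$). Nothing else is assumed about the joint law for different $N$. Set $$\xi=\frac1T\sum_{t=1}^T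 f_t^2\ \ (\text{so } T\xi\sim\chi^2_T),\qquad \Psi=\sqrt{1+\delta^2c_1/\xi}.$$ Let $S=T^{-1}\sum_{t}R_tR_t^\top$ be the sample covariance matrix. Almost surely for all large $N$ let $\hat\sigma^2$ be its largest eigenvalue and $\hat\beta$ a corresponding unit eigenvector with $\gamma_{\hat\beta,z}\ge0$. Let $\hat\delta=\hat\delta_N$ be any estimator of $\delta$ (an arbitrary random variable for each $N$) which is almost surely positive for all large $N$ and bounded above in $N$, and let $$\hat\Sigma=\hat\sigma^2\hat\beta\hat\beta^\top+\hat\delta^2 I .$$ For large $N$ let $w_*$ and $\hat w$ be the minimum variance portfolios for $\Sigma$ and $\hat\Sigma$, i.e. the minimizers of $w^\top\Sigma w$ and of $w^\top\hat\Sigma w$ over all $w\in\mathbb R^N$ with $w^\top1_N=1$. Define, with $\theta_{x,y}$ the angle between $x$ and $y$, $$\mathscr T^2_{\hat w}=(w_*-\hat w)^\top\Sigma(w_*-\hat w),\qquad \mathscr R_{\hat w}=\frac{\hat w^\top\hat\Sigma\hat w}{\hat w^\top\Sigma\hat w},\qquad \mathscr E=\frac{\gamma_{\beta,z}-\gamma_{\beta,\hat\beta}\,\gamma_{\hat\beta,z}}{\sin^2\theta_{\hat\beta,z}}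 .$$ Then almost surely $\Psi>1$ and, as $N\to\infty$: 1. $\cos\theta_{\hat\beta,\beta}\to\Psi^{-1}$; 2. $\mathscr T^2_{\hat w}$ is bounded away from zero, i.e. there is a (random) $c>0$ with $\mathscr T^2_{\hat w}\ge c$ for all large $N$; 3. $\mathscr R_{\hat w}\to0$; 4. $\displaystyle \mathscr E\sim\gamma_{\beta,z}\,\frac{1-\Psi^{-2}}{1-\Psi^{-2}\gamma_{\beta,z}^2}$, i.e. the two sides are asymptotically equivalent. -/

import Mathlib

open Filter Topology MeasureTheory ProbabilityTheory
open scoped Matrix RealInnerProductSpace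

namespace DispersionBias

noncomputable section

/-- The dispersionless unit vector `z = 1_N / √N`. -/
def zVec (N : ℕ) : EuclideanSpace ℝ (Fin N) :=
  WithLp.toLp 2 (fun _ => 1 / √(N : ℝ))

/-- The one-factor covariance matrix `s b bᵀ + d I` with factor variance `s`, exposures `b` and
homogeneous specific variance `d`. Both the true and the estimated covariance have this form. -/
def factorCov {N : ℕ} (s : ℝ) (b : EuclideanSpace ℝ (Fin N)) (d : ℝ) :
    Matrix (Fin N) (Fin N) ℝ :=
  s • Matrix.vecMulVec b b + d • (1 : Matrix (Fin N) (Fin N) ℝ)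

/-- The `N × T` data matrix whose `t`-th column is the `t`-th observed return vector. -/
def dataMatrix {N T : ℕ} (r : Fin T → EuclideanSpace ℝ (Fin N)) : Matrix (Fin N) (Fin T) ℝ :=
  Matrix.of fun n t => r t n

/-- The sample covariance matrix `S = T⁻¹ X Xᵀ` of the data matrix `X`. -/
def sampleCov {N T : ℕ} (r : Fin T → EuclideanSpace ℝ (Fin N)) : Matrix (Fin N) (Fin N) ℝ :=
  (T : ℝ)⁻¹ • (dataMatrix r * (dataMatrix r)ᵀ)

/-- `(s, b)` is a leading principal component of `S`, oriented towards `z`: `s` is the largest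
eigenvalue of `S` and `b` is a unit eigenvector for `s` with `bᵀ z ≥ 0`. -/
structure IsPCA {N : ℕ} (S : Matrix (Fin N) (Fin N) ℝ) (s : ℝ)
    (b : EuclideanSpace ℝ (Fin N)) : Prop where
  isGreatest : IsGreatest {l : ℝ | Module.End.HasEigenvalue (Matrix.toLin' S) l} s
  norm_eq_one : ‖b‖ = 1
  mulVec_eq : S *ᵥ b.ofLp = s • b.ofLp
  inner_nonneg : 0 ≤ ⟪b, zVec N⟫

/-- The portfolio variance `wᵀ S w`. -/
def portVar {N : ℕ} (S : Matrix (Fin N) (Fin N) ℝ) (w : Fin N → ℝ) : ℝ :=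
  w ⬝ᵥ (S *ᵥ w)

/-- `w` is a minimum variance portfolio for the covariance matrix `S`: it minimizes `wᵀ S w`
among the fully invested portfolios, `wᵀ 1 = 1`. -/
def IsMinVar {N : ℕ} (S : Matrix (Fin N) (Fin N) ℝ) (w : Fin N → ℝ) : Prop :=
  ∑ i, w i = 1 ∧ ∀ v : Fin N → ℝ, ∑ i, v i = 1 → portVar S w ≤ portVar S v

/-- The squared tracking error `(w_* - ŵ)ᵀ Σ (w_* - ŵ)`. -/
def trackingErrorSq {N : ℕ} (S : Matrix (Fin N) (Fin N) ℝ) (wstar what : Fin N → ℝ) : ℝ :=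
  portVar S (wstar - what)

/-- The variance forecast ratio `ŵᵀ Σ̂ ŵ / ŵᵀ Σ ŵ`. -/
def varForecastRatio {N : ℕ} (S Shat : Matrix (Fin N) (Fin N) ℝ) (what : Fin N → ℝ) : ℝ :=
  portVar Shat what / portVar S what

/-- The error term `(βᵀz - (βᵀβ̂)(β̂ᵀz)) / sin² θ`, where `θ` is the angle between `β̂` and `z`. -/
def errorTerm {N : ℕ} (b bhat : EuclideanSpace ℝ (Fin N)) : ℝ :=
  (⟪b, zVec N⟫ - ⟪b, bhat⟫ * ⟪bhat, zVec N⟫) /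
    Real.sin (InnerProductGeometry.angle bhat (zVec N)) ^ 2

/-- `ξ = T⁻¹ ∑ f_t²`; it equals `χ²_T / T` in law when the `f_t` are i.i.d. standard normal. -/
def xi {T : ℕ} (f : Fin T → ℝ) : ℝ := (T : ℝ)⁻¹ * ∑ t, f t ^ 2

/-- `Ψ = √(1 + δ² c₁ / ξ)`. -/
def psi {T : ℕ} (c₁ δ : ℝ) (f : Fin T → ℝ) : ℝ := √(1 + δ ^ 2 * c₁ / xi f)

end

end DispersionBias

open DispersionBias

/-! The nonzero spectrum of the `N × N` sample covariance is that of a `T × T` Gram matrix, and `T`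
is fixed. Divided by `N`, the Gram matrix has entries `⟪R_s, R_t⟫ / N`, and these split into a
factor part `(σ² / N) x xᵀ`, with `x_t = ⟪β, R_t⟫ / σ → f_t`, and a specific part that tends to `δ²
I`. Since `σ² / N → κ₀ = 1 / (T c₁)`, the limit is the rank one perturbation `κ₀ f fᵀ + δ² I`. With
`F = ∑ f_t²`, its top eigenvalue is `κ₀ F + δ²`, and the squared cosine between `βhat` and `β` tends
to `κ₀ F / (κ₀ F + δ²) = Ψ⁻²` (`gram_leading_eigenpair_tendsto`, `isPCA_limits`).

No joint law across different `N` is given, so the almost sure limits come from Borel–Cantelli with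
tails geometric in `N` (`ae_tendsto_zero_of_geometric_tail`).

The vector `βhat` is a combination of the returns, and the part of `z` orthogonal to `β` is
asymptotically invisible to them. Hence `⟪βhat, z⟫ - ⟪β, z⟫ ⟪β, βhat⟫ → 0`. Because `⟪β, z⟫` stays
away from `0`, the orientation of `βhat` then fixes the sign of the cosine.

Everything about portfolios is read off an explicit minimizer (`IsMinVar.inner_eq`). The rescaled
exposure `√N ⟪β, ŵ⟫` follows `γ (1 - Ψ⁻²) / (1 - Ψ⁻² γ²)`, where `γ = ⟪β, z⟫`; this is bounded
below, whereas the exposure of `w_*` vanishes. As `σ²` has order `N`, this gap alone keeps the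
tracking error and the true variance of `ŵ` away from zero, while the forecast variance is `O(1 /
N)`. The error term is the same exposure formula with shrinkage weight `1`. -/

namespace DispersionBias

/-! ### Geometric Gaussian tails and Borel–Cantelli -/

section Chernoff

/-- Above the mean, the exponential Chernoff bound is nontrivial for a suitable exponent. -/
lemma exists_exp_mul_mgf_lt_one {α : Type*} [MeasurableSpace α] {μ : Measure α}
    [IsProbabilityMeasure μ] {X : α → ℝ} (hX : 0 ∈ interior (integrableExpSet X μ))
    {a : ℝ} (ha : μ[X] < a) :
    ∃ t : ℝ, 0 < t ∧ Integrable (fun x => Real.exp (t * X x)) μ ∧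
      Real.exp (-t * a) * mgf X μ t < 1 := by
  -- The bound equals `1` at `t = 0` with derivative `μ[X] - a < 0`, so it drops below `1` just to
  -- the right of `0`.
  have hd : HasDerivAt (fun t => Real.exp (-t * a) * mgf X μ t) (μ[X] - a) 0 := by
    have h1 : HasDerivAt (fun t : ℝ => Real.exp (-t * a)) (-a) 0 := by
      have := (((hasDerivAt_id (0 : ℝ)).neg).mul_const a).exp
      simpa using this
    have h2 := hasDerivAt_mgf hX
    have h3 := h1.mul h2
    convert! h3 using 1
    simp
    ring
  have hslope := hasDerivAt_iff_tendsto_slope.1 hd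
  have hneg : ∀ᶠ t in 𝓝[>] (0 : ℝ),
      slope (fun t => Real.exp (-t * a) * mgf X μ t) 0 t < 0 :=
    (hslope.mono_left (nhdsWithin_mono _ fun t ht => ne_of_gt ht)).eventually_lt_const
      (sub_neg.2 ha)
  have hint : ∀ᶠ t in 𝓝[>] (0 : ℝ), t ∈ integrableExpSet X μ :=
    nhdsWithin_le_nhds (mem_interior_iff_mem_nhds.1 hX)
  obtain ⟨t, ⟨h1, h2⟩, h3⟩ := ((hneg.and hint).and self_mem_nhdsWithin).exists
  have h3' : 0 < t := h3
  refine ⟨t, h3', h2, ?_⟩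
  rw [slope_def_field, div_neg_iff] at h1
  rcases h1 with h1 | h1
  · linarith [h1.2]
  · have := h1.1
    simp only [neg_zero, zero_mul, Real.exp_zero, mgf_zero, one_mul] at this
    linarith

/-- Exponential tail bound for sums of functions of the coordinates of a product measure. -/
lemma exists_pi_real_sum_ge_le_pow {α : Type*} [MeasurableSpace α] {γ : Measure α}
    [IsProbabilityMeasure γ] {g : α → ℝ} (hg : 0 ∈ interior (integrableExpSet g γ))
    {a : ℝ} (ha : γ[g] < a) :
    ∃ q : ℝ, 0 ≤ q ∧ q < 1 ∧ ∀ N : ℕ,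
      (Measure.pi fun _ : Fin N => γ).real {x | N * a ≤ ∑ i, g (x i)} ≤ q ^ N := by
  obtain ⟨t, ht, hint, hlt⟩ := exists_exp_mul_mgf_lt_one hg ha
  refine ⟨_, mul_nonneg (Real.exp_pos _).le mgf_nonneg, hlt, fun N => ?_⟩
  have hexp : (fun x : Fin N → α => Real.exp (t * ∑ i, g (x i))) =
      fun x => ∏ i, Real.exp (t * g (x i)) := by
    ext x
    rw [Finset.mul_sum, Real.exp_sum]
  refine (measure_ge_le_exp_mul_mgf _ ht.le ?_).trans_eq ?_
  · rw [hexp]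
    exact Integrable.fintype_prod fun _ => hint
  · rw [mgf, hexp, integral_fintype_prod_eq_pow (f := fun y => Real.exp (t * g y)), mul_pow, ← Real.exp_nat_mul, Fintype.card_fin,
      mgf]
    ring_nf

/-- The squared norm is a sum of `N` independent squares of mean `1`. Fernique's theorem supplies
the exponential moments, and Chernoff is applied to `x²` for the upper tail and to `-x²` for the
lower one. -/
lemma exists_norm_sq_stdGaussian_tail {η : ℝ} (hη : 0 < η) :
    ∃ q : ℝ, 0 ≤ q ∧ q < 1 ∧ ∀ N : ℕ,
      (stdGaussian (EuclideanSpace ℝ (Fin N))).real {x | N * η ≤ |‖x‖ ^ 2 - N|} ≤ 2 * q ^ N := by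
  obtain ⟨C, hC, hCint⟩ := IsGaussian.exists_integrable_exp_sq (gaussianReal 0 1)
  have hmono : ∀ s : ℝ, s ≤ C → Integrable (fun x : ℝ => Real.exp (s * x ^ 2))
      (gaussianReal 0 1) := by
    intro s hs
    refine hCint.mono' (by fun_prop) (ae_of_all _ fun x => ?_)
    rw [Real.norm_eq_abs, Real.abs_exp, Real.norm_eq_abs, sq_abs]
    gcongr
  have hpos : 0 ∈ interior (integrableExpSet (fun x : ℝ => x ^ 2) (gaussianReal 0 1)) :=
    mem_interior_iff_mem_nhds.2 (mem_of_superset (Iic_mem_nhds hC) fun s hs => hmono s hs)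
  have hneg : 0 ∈ interior (integrableExpSet (fun x : ℝ => -x ^ 2) (gaussianReal 0 1)) := by
    refine mem_interior_iff_mem_nhds.2 (mem_of_superset (Ici_mem_nhds (neg_lt_zero.2 hC)) ?_)
    intro s hs
    have hs' : -C ≤ s := hs
    have := hmono (-s) (by linarith)
    simpa [integrableExpSet] using this
  have hsq : ∫ x : ℝ, x ^ 2 ∂(gaussianReal 0 1) = 1 := by
    have h := variance_eq_integral (μ := gaussianReal 0 1) (X := fun x : ℝ => x) (by fun_prop)
    rw [variance_fun_id_gaussianReal] at h
    simpa using h.symm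
  obtain ⟨q₁, hq₁, hq₁', h₁⟩ := exists_pi_real_sum_ge_le_pow hpos (a := 1 + η)
    (by rw [hsq]; linarith)
  obtain ⟨q₂, hq₂, hq₂', h₂⟩ := exists_pi_real_sum_ge_le_pow hneg (a := -1 + η)
    (by rw [integral_neg, hsq]; linarith)
  refine ⟨max q₁ q₂, le_max_of_le_left hq₁, max_lt hq₁' hq₂', fun N => ?_⟩
  rw [← map_pi_eq_stdGaussian, map_measureReal_apply (by fun_prop)
    (measurableSet_le (by fun_prop) (by fun_prop))]
  calc (Measure.pi fun _ : Fin N => gaussianReal 0 1).real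
        (WithLp.toLp 2 ⁻¹' {x : EuclideanSpace ℝ (Fin N) | N * η ≤ |‖x‖ ^ 2 - N|})
      ≤ (Measure.pi fun _ : Fin N => gaussianReal 0 1).real
        ({x | N * (1 + η) ≤ ∑ i, x i ^ 2} ∪ {x | N * (-1 + η) ≤ ∑ i, -x i ^ 2}) := by
        refine measureReal_mono fun x hx => ?_
        simp only [Set.mem_preimage, Set.mem_ofPred_eq, EuclideanSpace.real_norm_sq_eq] at hx
        simp only [Set.mem_union, Set.mem_ofPred_eq, Finset.sum_neg_distrib]
        rcases le_abs.1 hx with h | h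
        · left; linarith
        · right; linarith
    _ ≤ _ := measureReal_union_le _ _
    _ ≤ q₁ ^ N + q₂ ^ N := add_le_add (h₁ N) (h₂ N)
    _ ≤ max q₁ q₂ ^ N + max q₁ q₂ ^ N := by
        gcongr
        · exact le_max_left _ _
        · exact le_max_right _ _
    _ = 2 * max q₁ q₂ ^ N := by ring

/-- The marginal along `u` is centred normal with variance `‖u‖² ≤ 1`. The inequality, rather than
equality, is needed for the residual of `z` orthogonal to `β`. -/
lemma inner_stdGaussian_tail {E : Type*} [NormedAddCommGroup E] [InnerProductSpace ℝ E]
    [FiniteDimensional ℝ E] [MeasurableSpace E] [BorelSpace E] {u : E} (hu : ‖u‖ ≤ 1)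
    {a : ℝ} (ha : 0 ≤ a) :
    (stdGaussian E).real {x | a ≤ |⟪u, x⟫|} ≤ 2 * Real.exp (-a ^ 2 / 2) := by
  have hsub : ∀ v : E, ‖v‖ ≤ 1 → HasSubgaussianMGF (fun x => ⟪v, x⟫) 1 (stdGaussian E) := by
    intro v hv
    have hmap : (stdGaussian E).map (innerSL ℝ v) =
        gaussianReal 0 (‖v‖ ^ 2).toNNReal := by
      rw [IsGaussian.map_eq_gaussianReal, integral_strongDual_stdGaussian,
        variance_dual_stdGaussian, innerSL_apply_norm]
    have hmgf := mgf_gaussianReal hmap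
    constructor
    · intro t
      have h1 : Integrable (fun y => Real.exp (t * y)) ((stdGaussian E).map (innerSL ℝ v)) := by
        rw [hmap]; exact integrable_exp_mul_gaussianReal t
      exact h1.comp_measurable (by fun_prop)
    · intro t
      refine (hmgf t).trans_le ?_
      rw [Real.coe_toNNReal _ (by positivity)]
      simp only [NNReal.coe_one, zero_mul, zero_add, one_mul]
      gcongr
      have : ‖v‖ ^ 2 ≤ 1 := by nlinarith [norm_nonneg v]
      nlinarith [sq_nonneg t]
  calc (stdGaussian E).real {x | a ≤ |⟪u, x⟫|}
      ≤ (stdGaussian E).real ({x | a ≤ ⟪u, x⟫} ∪ {x | a ≤ ⟪-u, x⟫}) := by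
        refine measureReal_mono fun x hx => ?_
        simpa [inner_neg_left] using le_abs.1 hx
    _ ≤ _ := measureReal_union_le _ _
    _ ≤ Real.exp (-a ^ 2 / 2) + Real.exp (-a ^ 2 / 2) := by
        refine add_le_add ?_ ?_
        · simpa using (hsub u hu).measure_ge_le ha
        · simpa using (hsub (-u) (by simpa using hu)).measure_ge_le ha
    _ = _ := by ring

/-- Borel–Cantelli for geometrically small deviation probabilities. -/
lemma ae_tendsto_zero_of_geometric_tail {Ω : Type*} [MeasurableSpace Ω] {P : Measure Ω}
    [IsProbabilityMeasure P] {Y : ℕ → Ω → ℝ}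
    (h : ∀ η : ℝ, 0 < η → ∃ C q : ℝ, 0 ≤ q ∧ q < 1 ∧
      ∀ N : ℕ, 1 ≤ N → P.real {ω | η ≤ |Y N ω|} ≤ C * q ^ N) :
    ∀ᵐ ω ∂P, Tendsto (fun N => Y N ω) atTop (𝓝 0) := by
  have key : ∀ k : ℕ, ∀ᵐ ω ∂P, ∀ᶠ N in atTop, |Y N ω| < 1 / ((k : ℝ) + 1) := by
    intro k
    obtain ⟨C, q, hq0, hq1, hle⟩ := h (1 / ((k : ℝ) + 1)) (by positivity)
    -- The index is shifted by one because the tail bound is only available for `N ≥ 1`.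
    have hsum : Summable fun N : ℕ => P.real {ω | 1 / ((k : ℝ) + 1) ≤ |Y (N + 1) ω|} := by
      refine Summable.of_nonneg_of_le (fun _ => measureReal_nonneg)
        (fun N => hle (N + 1) (by omega)) ?_
      exact ((summable_nat_add_iff 1).2 (summable_geometric_of_lt_one hq0 hq1)).mul_left C
    have hne : (∑' N : ℕ, P {ω | 1 / ((k : ℝ) + 1) ≤ |Y (N + 1) ω|}) ≠ ⊤ := by
      have := hsum.tsum_ofReal_ne_top
      simpa [ofReal_measureReal] using this
    filter_upwards [ae_eventually_notMem hne] with ω hω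
    rw [← map_add_atTop_eq_nat 1, eventually_map]
    simpa using hω
  filter_upwards [ae_all_iff.2 key] with ω hω
  rw [Metric.tendsto_atTop']
  intro ε hε
  obtain ⟨k, hk⟩ := exists_nat_one_div_lt hε
  obtain ⟨N, hN⟩ := eventually_atTop.1 (hω k)
  exact ⟨N, fun n hn => by simpa [Real.dist_eq] using (hN n hn.le).trans hk⟩

end Chernoff

/-! ### The factor covariance and its square root -/

section FactorLaw

variable {N : ℕ}

lemma factorCov_mulVec (s : ℝ) (b : EuclideanSpace ℝ (Fin N)) (d : ℝ) (x : Fin N → ℝ) :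
    factorCov s b d *ᵥ x = (s * (b.ofLp ⬝ᵥ x)) • b.ofLp + d • x := by
  rw [factorCov, Matrix.add_mulVec, Matrix.smul_mulVec, Matrix.smul_mulVec, Matrix.one_mulVec,
    Matrix.vecMulVec_mulVec]
  ext i
  simp
  ring

lemma portVar_factorCov (s : ℝ) (b : EuclideanSpace ℝ (Fin N)) (d : ℝ)
    (x : EuclideanSpace ℝ (Fin N)) :
    portVar (factorCov s b d) x.ofLp = s * ⟪b, x⟫ ^ 2 + d * ‖x‖ ^ 2 := by
  rw [portVar, factorCov_mulVec, ← real_inner_self_eq_norm_sq]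
  simp only [EuclideanSpace.inner_eq_star_dotProduct, star_trivial, dotProduct_add,
    dotProduct_smul, smul_eq_mul]
  rw [dotProduct_comm b.ofLp x.ofLp]
  ring

lemma posSemidef_factorCov {s d : ℝ} (hs : 0 ≤ s) (hd : 0 ≤ d)
    (b : EuclideanSpace ℝ (Fin N)) : (factorCov s b d).PosSemidef := by
  refine Matrix.PosSemidef.add (Matrix.PosSemidef.smul ?_ hs) (Matrix.PosSemidef.one.smul hd)
  simpa using Matrix.posSemidef_vecMulVec_self_star b.ofLp

/-- A square root of the factor covariance, as a linear map. -/
noncomputable def factorSqrt (s : ℝ) (b : EuclideanSpace ℝ (Fin N)) (d : ℝ) :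
    EuclideanSpace ℝ (Fin N) →L[ℝ] EuclideanSpace ℝ (Fin N) :=
  √d • ContinuousLinearMap.id ℝ _ + (√(s + d) - √d) • (innerSL ℝ b).smulRight b

lemma factorSqrt_apply (s : ℝ) (b : EuclideanSpace ℝ (Fin N)) (d : ℝ)
    (x : EuclideanSpace ℝ (Fin N)) :
    factorSqrt s b d x = √d • x + ((√(s + d) - √d) * ⟪b, x⟫) • b := by
  simp [factorSqrt, smul_smul]

lemma inner_factorSqrt (s : ℝ) (b : EuclideanSpace ℝ (Fin N)) (d : ℝ)
    (x y : EuclideanSpace ℝ (Fin N)) :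
    ⟪factorSqrt s b d x, y⟫ = ⟪x, factorSqrt s b d y⟫ := by
  simp only [factorSqrt_apply, inner_add_left, inner_add_right, real_inner_smul_left,
    real_inner_smul_right]
  rw [real_inner_comm b x]
  ring

lemma inner_self_factorSqrt (s d : ℝ) {b : EuclideanSpace ℝ (Fin N)} (hb : ‖b‖ = 1) (x : EuclideanSpace ℝ (Fin N)) :
    ⟪b, factorSqrt s b d x⟫ = √(s + d) * ⟪b, x⟫ := by
  rw [factorSqrt_apply, inner_add_right, real_inner_smul_right, real_inner_smul_right,
    real_inner_self_eq_norm_sq, hb]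
  ring

lemma inner_factorSqrt_of_orthogonal (s d : ℝ)
    {b w : EuclideanSpace ℝ (Fin N)} (hw : ⟪w, b⟫ = 0) (x : EuclideanSpace ℝ (Fin N)) :
    ⟪w, factorSqrt s b d x⟫ = √d * ⟪w, x⟫ := by
  rw [factorSqrt_apply, inner_add_right, real_inner_smul_right, real_inner_smul_right, hw]
  ring

lemma norm_sq_factorSqrt {s d : ℝ} (hs : 0 ≤ s) (hd : 0 ≤ d)
    {b : EuclideanSpace ℝ (Fin N)} (hb : ‖b‖ = 1) (x : EuclideanSpace ℝ (Fin N)) :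
    ‖factorSqrt s b d x‖ ^ 2 = s * ⟪b, x⟫ ^ 2 + d * ‖x‖ ^ 2 := by
  have h1 := Real.sq_sqrt hd
  have h2 := Real.sq_sqrt (add_nonneg hs hd)
  rw [factorSqrt_apply, norm_add_sq_real, norm_smul, norm_smul, mul_pow, mul_pow, hb,
    Real.norm_eq_abs, Real.norm_eq_abs, sq_abs, sq_abs, real_inner_smul_left,
    real_inner_smul_right, real_inner_comm b x]
  linear_combination (‖x‖ ^ 2 - ⟪b, x⟫ ^ 2) * h1 + ⟪b, x⟫ ^ 2 * h2

/-- Characteristic functions agree: the root is self-adjoint, so it moves onto the argument, where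
its squared norm is the quadratic form of the covariance. Tail estimates thereby reduce to the
standard Gaussian. -/
lemma multivariateGaussian_factorCov {s d : ℝ} (hs : 0 ≤ s) (hd : 0 ≤ d)
    {b : EuclideanSpace ℝ (Fin N)} (hb : ‖b‖ = 1) :
    multivariateGaussian 0 (factorCov s b d) =
      (stdGaussian (EuclideanSpace ℝ (Fin N))).map (factorSqrt s b d) := by
  refine Measure.ext_of_charFun (funext fun x => ?_)
  have h : charFun ((stdGaussian (EuclideanSpace ℝ (Fin N))).map (factorSqrt s b d)) x =
      charFun (stdGaussian (EuclideanSpace ℝ (Fin N))) (factorSqrt s b d x) := by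
    rw [charFun_apply, charFun_apply, integral_map (by fun_prop) (by fun_prop)]
    simp_rw [inner_factorSqrt]
  rw [charFun_multivariateGaussian (posSemidef_factorCov hs hd b), h, charFun_stdGaussian,
    ← Complex.ofReal_pow, norm_sq_factorSqrt hs hd hb, ← portVar_factorCov, portVar]
  simp [neg_div]

end FactorLaw

/-! ### Almost sure limits of the specific returns -/

section AlmostSureLimits

variable {Ω : Type*} [MeasurableSpace Ω] {P : Measure Ω}

lemma measureReal_of_hasLaw_factorCov {N : ℕ} {s d : ℝ} (hs : 0 ≤ s) (hd : 0 ≤ d)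
    {b : EuclideanSpace ℝ (Fin N)} (hb : ‖b‖ = 1) {Y : Ω → EuclideanSpace ℝ (Fin N)}
    (hY : HasLaw Y (multivariateGaussian 0 (factorCov s b d)) P)
    {p : EuclideanSpace ℝ (Fin N) → Prop} (hp : MeasurableSet {x | p x}) :
    P.real {ω | p (Y ω)} =
      (stdGaussian (EuclideanSpace ℝ (Fin N))).real {x | p (factorSqrt s b d x)} := by
  rw [measureReal_def, measureReal_def, hY.measure_eq hp, multivariateGaussian_factorCov hs hd hb,
    Measure.map_apply (by fun_prop) hp]
  rfl

/-- A standard normal sample almost surely has positive second empirical moment. -/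
lemma ae_sum_sq_pos {T : ℕ} (hT : 1 ≤ T) {f : Fin T → Ω → ℝ}
    (hf : ∀ t, HasLaw (f t) (gaussianReal 0 1) P) : ∀ᵐ ω ∂P, 0 < ∑ t, f t ω ^ 2 := by
  have h0 : ∀ᵐ ω ∂P, f ⟨0, hT⟩ ω ≠ 0 := by
    have := nullSingletonClass_gaussianReal (μ := 0) (v := 1) one_ne_zero
    rw [ae_iff]
    simp only [not_not]
    rw [(hf ⟨0, hT⟩).measure_eq (p := fun x => x = 0) (by simp)]
    simp
  filter_upwards [h0] with ω hω
  exact Finset.sum_pos' (fun t _ => sq_nonneg _) ⟨⟨0, hT⟩, Finset.mem_univ _, by positivity⟩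

variable [IsProbabilityMeasure P] {b : ∀ N : ℕ, EuclideanSpace ℝ (Fin N)} {s : ℕ → ℝ} {d : ℝ}
  {Y : ∀ N : ℕ, Ω → EuclideanSpace ℝ (Fin N)}

/-- The specific part of a factor model return has squared norm of order `N d`. -/
lemma ae_tendsto_specific_norm_sq (hb : ∀ N, 1 ≤ N → ‖b N‖ = 1) (hs : ∀ N, 0 ≤ s N)
    (hd : 0 ≤ d)
    (hY : ∀ N, HasLaw (Y N) (multivariateGaussian 0 (factorCov (s N) (b N) d)) P) :
    ∀ᵐ ω ∂P, Tendsto (fun N => (‖Y N ω‖ ^ 2 - ⟪b N, Y N ω⟫ ^ 2) / N) atTop (𝓝 d) := by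
  have h : ∀ᵐ ω ∂P,
      Tendsto (fun N => (‖Y N ω‖ ^ 2 - ⟪b N, Y N ω⟫ ^ 2) / N - d) atTop (𝓝 0) := by
    refine ae_tendsto_zero_of_geometric_tail fun η hη => ?_
    -- The deviation splits into the fluctuation of `‖x‖²` and the single square `⟪b, x⟫²`, each
    -- allowed `N * e`; the `d + 1` also covers `d = 0`.
    set e : ℝ := η / (d + 1) / 2 with he
    have he0 : 0 < e := by positivity
    have hde : d * (2 * e) ≤ η := by
      rw [he, show d * (2 * (η / (d + 1) / 2)) = d * η / (d + 1) by ring, div_le_iff₀ (by linarith)]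
      nlinarith
    obtain ⟨q, hq0, hq1, hq⟩ := exists_norm_sq_stdGaussian_tail he0
    set r : ℝ := Real.exp (-e / 2) with hr
    have hr1 : r < 1 := Real.exp_lt_one_iff.2 (by linarith)
    refine ⟨4, max q r, le_max_of_le_left hq0, max_lt hq1 hr1, fun N hN => ?_⟩
    have hN0 : (0 : ℝ) < N := by exact_mod_cast hN
    rw [measureReal_of_hasLaw_factorCov (hs N) hd (hb N hN) (hY N)
      (p := fun x => η ≤ |(‖x‖ ^ 2 - ⟪b N, x⟫ ^ 2) / N - d|)
      (measurableSet_le (by fun_prop) (by fun_prop))]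
    calc (stdGaussian (EuclideanSpace ℝ (Fin N))).real {x | η ≤
            |(‖factorSqrt (s N) (b N) d x‖ ^ 2 - ⟪b N, factorSqrt (s N) (b N) d x⟫ ^ 2) / N - d|}
        ≤ (stdGaussian (EuclideanSpace ℝ (Fin N))).real
          ({x | N * e ≤ |‖x‖ ^ 2 - N|} ∪ {x | √(N * e) ≤ |⟪b N, x⟫|}) := by
          refine measureReal_mono fun x hx => ?_
          simp only [Set.mem_ofPred_eq, norm_sq_factorSqrt (hs N) hd (hb N hN),
            inner_self_factorSqrt _ _ (hb N hN), mul_pow,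
            Real.sq_sqrt (add_nonneg (hs N) hd)] at hx
          simp only [Set.mem_union, Set.mem_ofPred_eq]
          by_contra! hcon
          obtain ⟨h1, h2⟩ := hcon
          have h2' : ⟪b N, x⟫ ^ 2 < N * e := by
            rw [← sq_abs]
            exact (Real.lt_sqrt (abs_nonneg _)).1 h2
          have h3 : |‖x‖ ^ 2 - N - ⟪b N, x⟫ ^ 2| < 2 * e * N := by
            rw [abs_lt] at h1 ⊢
            constructor <;> nlinarith [sq_nonneg ⟪b N, x⟫]
          have h4 : (s N * ⟪b N, x⟫ ^ 2 + d * ‖x‖ ^ 2 - (s N + d) * ⟪b N, x⟫ ^ 2) / N - d =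
              d * ((‖x‖ ^ 2 - N - ⟪b N, x⟫ ^ 2) / N) := by
            field_simp
            ring
          rw [h4, abs_mul, abs_of_nonneg hd, abs_div, abs_of_pos hN0] at hx
          have h5 : |‖x‖ ^ 2 - N - ⟪b N, x⟫ ^ 2| / N < 2 * e := by
            rwa [div_lt_iff₀ hN0]
          rcases hd.eq_or_lt with hd0 | hd0
          · rw [← hd0, zero_mul] at hx
            linarith
          · have := mul_lt_mul_of_pos_left h5 hd0
            linarith
      _ ≤ _ := measureReal_union_le _ _
      _ ≤ 2 * q ^ N + 2 * r ^ N := by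
          refine add_le_add (hq N) ?_
          refine (inner_stdGaussian_tail (hb N hN).le (Real.sqrt_nonneg _)).trans_eq ?_
          rw [Real.sq_sqrt (by positivity), hr, ← Real.exp_nat_mul]
          ring_nf
      _ ≤ 2 * max q r ^ N + 2 * max q r ^ N := by
          gcongr
          · exact le_max_left _ _
          · exact le_max_right _ _
      _ = 4 * max q r ^ N := by ring
  filter_upwards [h] with ω hω
  simpa using hω.add_const d

/-- A bounded linear functional of the specific return is negligible against `√N`. -/
lemma ae_tendsto_inner_specific (hb : ∀ N, 1 ≤ N → ‖b N‖ = 1) (hs : ∀ N, 0 ≤ s N)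
    (hd : 0 ≤ d)
    (hY : ∀ N, HasLaw (Y N) (multivariateGaussian 0 (factorCov (s N) (b N) d)) P)
    {w : ∀ N : ℕ, EuclideanSpace ℝ (Fin N)} (hw : ∀ N, 1 ≤ N → ‖w N‖ ≤ 1)
    (hwb : ∀ N, 1 ≤ N → ⟪w N, b N⟫ = 0) :
    ∀ᵐ ω ∂P, Tendsto (fun N => ⟪w N, Y N ω⟫ / √(N : ℝ)) atTop (𝓝 0) := by
  refine ae_tendsto_zero_of_geometric_tail fun η hη => ?_
  set e : ℝ := η / (√d + 1) with he
  have he0 : 0 < e := by positivity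
  have hde : √d * e < η := by
    rw [he, show √d * (η / (√d + 1)) = √d * η / (√d + 1) by ring, div_lt_iff₀ (by positivity)]
    nlinarith
  refine ⟨2, Real.exp (-e ^ 2 / 2), (Real.exp_pos _).le,
    Real.exp_lt_one_iff.2 (by nlinarith), fun N hN => ?_⟩
  have hN0 : (0 : ℝ) < N := by exact_mod_cast hN
  rw [measureReal_of_hasLaw_factorCov (hs N) hd (hb N hN) (hY N)
    (p := fun x => η ≤ |⟪w N, x⟫ / √(N : ℝ)|) (measurableSet_le (by fun_prop) (by fun_prop))]
  calc (stdGaussian (EuclideanSpace ℝ (Fin N))).real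
        {x | η ≤ |⟪w N, factorSqrt (s N) (b N) d x⟫ / √(N : ℝ)|}
      ≤ (stdGaussian (EuclideanSpace ℝ (Fin N))).real {x | e * √(N : ℝ) ≤ |⟪w N, x⟫|} := by
        refine measureReal_mono fun x hx => ?_
        simp only [Set.mem_ofPred_eq, inner_factorSqrt_of_orthogonal _ _ (hwb N hN)] at hx
        simp only [Set.mem_ofPred_eq]
        by_contra! hcon
        rw [abs_div, abs_mul, abs_of_nonneg (Real.sqrt_nonneg d),
          abs_of_nonneg (Real.sqrt_nonneg (N : ℝ)), le_div_iff₀ (by positivity)] at hx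
        have := mul_le_mul_of_nonneg_left hcon.le (Real.sqrt_nonneg d)
        have := mul_lt_mul_of_pos_right hde (Real.sqrt_pos.2 hN0)
        linarith
    _ ≤ 2 * Real.exp (-(e * √(N : ℝ)) ^ 2 / 2) :=
        inner_stdGaussian_tail (hw N hN) (by positivity)
    _ = 2 * Real.exp (-e ^ 2 / 2) ^ N := by
        rw [mul_pow, Real.sq_sqrt hN0.le, ← Real.exp_nat_mul]
        ring_nf

/-- This serves polarization: the sum again follows a factor model with the same `b`, so the norm
limit applies to it too. -/
lemma hasLaw_add_factorCov {N : ℕ} {s d : ℝ} (hs : 0 ≤ s) (hd : 0 ≤ d)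
    {b : EuclideanSpace ℝ (Fin N)} {X Y : Ω → EuclideanSpace ℝ (Fin N)}
    (hX : HasLaw X (multivariateGaussian 0 (factorCov s b d)) P)
    (hY : HasLaw Y (multivariateGaussian 0 (factorCov s b d)) P) (hXY : IndepFun X Y P) :
    HasLaw (fun ω => X ω + Y ω) (multivariateGaussian 0 (factorCov (2 * s) b (2 * d))) P := by
  refine ⟨hX.aemeasurable.add hY.aemeasurable, Measure.ext_of_charFun ?_⟩
  rw [hXY.charFun_map_fun_add_eq_mul hX.aemeasurable hY.aemeasurable, hX.map_eq, hY.map_eq]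
  ext x
  have h2 : x.ofLp ⬝ᵥ factorCov (2 * s) b (2 * d) *ᵥ x.ofLp =
      2 * (x.ofLp ⬝ᵥ factorCov s b d *ᵥ x.ofLp) := by
    have h1 := portVar_factorCov (2 * s) b (2 * d) x
    have h2 := portVar_factorCov s b d x
    rw [portVar] at h1 h2
    rw [h1, h2]
    ring
  rw [Pi.mul_apply, charFun_multivariateGaussian (posSemidef_factorCov hs hd b),
    charFun_multivariateGaussian (posSemidef_factorCov (by positivity) (by positivity) b),
    ← Complex.exp_add, h2, inner_zero_right]
  push_cast
  congr 1
  ring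

/-- The specific parts of independent factor model returns are asymptotically orthogonal. -/
lemma ae_tendsto_specific_inner (hb : ∀ N, 1 ≤ N → ‖b N‖ = 1) (hs : ∀ N, 0 ≤ s N)
    (hd : 0 ≤ d) {X : ∀ N : ℕ, Ω → EuclideanSpace ℝ (Fin N)}
    (hX : ∀ N, HasLaw (X N) (multivariateGaussian 0 (factorCov (s N) (b N) d)) P)
    (hY : ∀ N, HasLaw (Y N) (multivariateGaussian 0 (factorCov (s N) (b N) d)) P)
    (hXY : ∀ N, IndepFun (X N) (Y N) P) :
    ∀ᵐ ω ∂P, Tendsto (fun N => (⟪X N ω, Y N ω⟫ - ⟪b N, X N ω⟫ * ⟪b N, Y N ω⟫) / N)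
      atTop (𝓝 0) := by
  filter_upwards [ae_tendsto_specific_norm_sq hb hs hd hX, ae_tendsto_specific_norm_sq hb hs hd hY,
    ae_tendsto_specific_norm_sq hb (fun N => mul_nonneg zero_le_two (hs N)) (by positivity)
      (fun N => hasLaw_add_factorCov (hs N) hd (hX N) (hY N) (hXY N))] with ω h1 h2 h3
  -- Polarization: the specific norms of `X + Y`, `X` and `Y` contribute `2 d`, `d` and `d`.
  have h := ((h3.sub h1).sub h2).div_const 2
  rw [show (2 * d - d - d) / 2 = 0 by ring] at h
  refine h.congr fun N => ?_
  rw [norm_add_sq_real, inner_add_right]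
  ring

end AlmostSureLimits

/-! ### Explicit minimum variance portfolios -/

section MinimumVariance

/-- Sherman–Morrison suggests the candidate `w₀`. It is orthogonal to every feasible direction for
the positive definite form, so any minimizer must coincide with it. -/
lemma eq_of_isMin_factor_quadratic {E : Type*} [NormedAddCommGroup E] [InnerProductSpace ℝ E]
    {s d c : ℝ} (hs : 0 ≤ s) (hd : 0 < d) {b z w : E} (hb : ‖b‖ = 1) (hz : ‖z‖ = 1)
    (hw : ⟪w, z⟫ = c)
    (hmin : ∀ v, ⟪v, z⟫ = c → s * ⟪b, w⟫ ^ 2 + d * ‖w‖ ^ 2 ≤ s * ⟪b, v⟫ ^ 2 + d * ‖v‖ ^ 2) :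
    0 < 1 - s / (s + d) * ⟪b, z⟫ ^ 2 ∧
    w = (c / (1 - s / (s + d) * ⟪b, z⟫ ^ 2)) • (z - (s / (s + d) * ⟪b, z⟫) • b) ∧
    s * ⟪b, w⟫ ^ 2 + d * ‖w‖ ^ 2 = c ^ 2 * d / (1 - s / (s + d) * ⟪b, z⟫ ^ 2) := by
  set g := ⟪b, z⟫ with hg
  set ρ := s / (s + d) with hρ
  have hsd : 0 < s + d := by linarith
  have hg1 : g ^ 2 ≤ 1 := by
    have := abs_real_inner_le_norm b z
    rw [hb, hz, mul_one] at this
    rw [← sq_abs]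
    nlinarith [abs_nonneg g]
  have hρ1 : ρ < 1 := by rw [hρ, div_lt_one hsd]; linarith
  have hρ0 : 0 ≤ ρ := by positivity
  have hρsd : ρ * (s + d) = s := by rw [hρ]; field_simp
  have hD : 0 < 1 - ρ * g ^ 2 := by nlinarith
  set a := c / (1 - ρ * g ^ 2) with ha
  have haD : a * (1 - ρ * g ^ 2) = c := by rw [ha]; field_simp
  set w₀ : E := a • (z - (ρ * g) • b) with hw₀
  have hbw₀ : ⟪b, w₀⟫ = a * (1 - ρ) * g := by
    rw [hw₀, real_inner_smul_right, inner_sub_right, real_inner_smul_right,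
      real_inner_self_eq_norm_sq, hb]
    ring
  have hw₀z : ⟪w₀, z⟫ = c := by
    rw [hw₀, real_inner_smul_left, inner_sub_left, real_inner_smul_left,
      real_inner_self_eq_norm_sq, hz, ← hg, ← haD]
    ring
  -- The bilinear form against `w₀` is constant on the constraint plane; hence the form at `w - w₀`
  -- is its value at `w` minus its value at `w₀`.
  have hpolar : ∀ v, ⟪v, z⟫ = c → s * ⟪b, v⟫ * ⟪b, w₀⟫ + d * ⟪v, w₀⟫ = a * d * c := by
    intro v hv
    rw [hbw₀, hw₀, real_inner_smul_right, inner_sub_right, real_inner_smul_right, hv,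
      real_inner_comm b v]
    linear_combination (-a * ⟪b, v⟫ * g) * hρsd
  have h1 := hpolar w hw
  have h2 := hpolar w₀ hw₀z
  rw [real_inner_self_eq_norm_sq] at h2
  have h3 := hmin w₀ hw₀z
  have h4 : s * ⟪b, w - w₀⟫ ^ 2 + d * ‖w - w₀‖ ^ 2 ≤ 0 := by
    rw [inner_sub_right, norm_sub_sq_real]
    nlinarith
  have h5 : ‖w - w₀‖ ^ 2 ≤ 0 := by
    have : 0 ≤ s * ⟪b, w - w₀⟫ ^ 2 := by positivity
    have h6 : d * ‖w - w₀‖ ^ 2 ≤ 0 := by linarith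
    exact nonpos_of_mul_nonpos_right h6 hd
  have h6 : w = w₀ := by
    rw [← sub_eq_zero, ← norm_eq_zero]
    exact pow_eq_zero_iff two_ne_zero |>.1 (le_antisymm h5 (sq_nonneg _))
  refine ⟨hD, h6, ?_⟩
  rw [h6]
  calc s * ⟪b, w₀⟫ ^ 2 + d * ‖w₀‖ ^ 2 = a * d * c := by rw [← h2]; ring
    _ = c ^ 2 * d / (1 - ρ * g ^ 2) := by rw [ha]; ring

lemma norm_zVec {N : ℕ} (hN : 1 ≤ N) : ‖zVec N‖ = 1 := by
  have hN0 : (0 : ℝ) < N := by exact_mod_cast hN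
  rw [EuclideanSpace.norm_eq, Real.sqrt_eq_one]
  simp [zVec]
  field_simp

lemma sum_eq_sqrt_mul_inner_zVec {N : ℕ} (hN : 1 ≤ N) (w : EuclideanSpace ℝ (Fin N)) :
    ∑ i, w.ofLp i = √(N : ℝ) * ⟪w, zVec N⟫ := by
  have hN0 : (0 : ℝ) < √(N : ℝ) := by positivity
  rw [EuclideanSpace.inner_eq_star_dotProduct]
  simp only [zVec, dotProduct, star_trivial, ← Finset.mul_sum]
  field_simp

/-- The exposure of a minimum variance portfolio to a factor, and its variance. -/
lemma IsMinVar.inner_eq {N : ℕ} (hN : 1 ≤ N) {s d : ℝ} (hs : 0 ≤ s) (hd : 0 < d)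
    {b : EuclideanSpace ℝ (Fin N)} (hb : ‖b‖ = 1) {w : Fin N → ℝ}
    (hw : IsMinVar (factorCov s b d) w) :
    0 < 1 - s / (s + d) * ⟪b, zVec N⟫ ^ 2 ∧
    (∀ β : EuclideanSpace ℝ (Fin N), √(N : ℝ) * ⟪β, WithLp.toLp 2 w⟫ =
      (⟪β, zVec N⟫ - s / (s + d) * ⟪b, zVec N⟫ * ⟪β, b⟫) /
        (1 - s / (s + d) * ⟪b, zVec N⟫ ^ 2)) ∧
    portVar (factorCov s b d) w = d / N / (1 - s / (s + d) * ⟪b, zVec N⟫ ^ 2) := by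
  have hN0 : (0 : ℝ) < √(N : ℝ) := by positivity
  have hNs : √(N : ℝ) ^ 2 = N := Real.sq_sqrt (by positivity)
  have key := eq_of_isMin_factor_quadratic hs hd hb (norm_zVec hN) (w := WithLp.toLp 2 w)
    (c := 1 / √(N : ℝ)) ?_ ?_
  · obtain ⟨h1, h2, h3⟩ := key
    refine ⟨h1, fun β => ?_, ?_⟩
    · rw [h2, real_inner_smul_right, inner_sub_right, real_inner_smul_right]
      field_simp
    · have := portVar_factorCov s b d (WithLp.toLp 2 w)
      rw [this, h3, div_pow, hNs]
      ring
  · have := sum_eq_sqrt_mul_inner_zVec hN (WithLp.toLp 2 w)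
    rw [eq_div_iff hN0.ne', mul_comm, ← this]
    exact hw.1
  · intro v hv
    rw [← portVar_factorCov, ← portVar_factorCov]
    refine hw.2 _ ?_
    rw [sum_eq_sqrt_mul_inner_zVec hN, hv]
    field_simp

end MinimumVariance

/-! ### The leading sample eigenpair -/

section PrincipalComponent

variable {N T : ℕ} {r : Fin T → EuclideanSpace ℝ (Fin N)}

lemma toLp_sampleCov_mulVec (r : Fin T → EuclideanSpace ℝ (Fin N))
    (y : EuclideanSpace ℝ (Fin N)) :
    WithLp.toLp 2 (sampleCov r *ᵥ y.ofLp) = (T : ℝ)⁻¹ • ∑ t, ⟪r t, y⟫ • r t := by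
  ext i
  rw [sampleCov, Matrix.smul_mulVec, ← Matrix.mulVec_mulVec]
  simp only [Pi.smul_apply, PiLp.smul_apply, WithLp.ofLp_sum, Finset.sum_apply, Matrix.mulVec,
    dotProduct, dataMatrix, Matrix.of_apply, Matrix.transpose_apply, smul_eq_mul, PiLp.inner_apply,
    RCLike.inner_apply, conj_trivial, WithLp.ofLp_smul]
  congr 1
  refine Finset.sum_congr rfl fun t _ => ?_
  rw [mul_comm]
  congr 1
  exact Finset.sum_congr rfl fun j _ => mul_comm _ _

lemma inner_sampleCov_mulVec (r : Fin T → EuclideanSpace ℝ (Fin N))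
    (y : EuclideanSpace ℝ (Fin N)) :
    ⟪WithLp.toLp 2 (sampleCov r *ᵥ y.ofLp), y⟫ = (T : ℝ)⁻¹ * ∑ t, ⟪r t, y⟫ ^ 2 := by
  rw [toLp_sampleCov_mulVec, real_inner_smul_left, sum_inner]
  simp only [real_inner_smul_left, sq]

lemma isHermitian_sampleCov (r : Fin T → EuclideanSpace ℝ (Fin N)) :
    (sampleCov r).IsHermitian := by
  rw [Matrix.IsHermitian, Matrix.conjTranspose_eq_transpose_of_trivial, sampleCov,
    Matrix.transpose_smul, Matrix.transpose_mul, Matrix.transpose_transpose]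

variable {s : ℝ} {b : EuclideanSpace ℝ (Fin N)}

/-- This carries the eigenvector equation to the `T`-dimensional side: pairing with a return gives
the Gram eigenvector equation, pairing with `β` or `z` gives the overlaps. -/
lemma IsPCA.sum_inner_smul (h : IsPCA (sampleCov r) s b) (hT : 1 ≤ T) :
    ∑ t, ⟪r t, b⟫ • r t = (T * s) • b := by
  have hT0 : (T : ℝ) ≠ 0 := by positivity
  have h1 := toLp_sampleCov_mulVec r b
  rw [h.mulVec_eq] at h1
  have h2 : s • b = (T : ℝ)⁻¹ • ∑ t, ⟪r t, b⟫ • r t := by rw [← h1]; rfl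
  rw [mul_smul, h2, smul_smul, mul_inv_cancel₀ hT0, one_smul]

/-- The leading eigenvalue bounds the Rayleigh quotient of the sample covariance matrix. -/
lemma IsPCA.sum_inner_sq_le (h : IsPCA (sampleCov r) s b) (hT : 1 ≤ T)
    (y : EuclideanSpace ℝ (Fin N)) : ∑ t, ⟪r t, y⟫ ^ 2 ≤ T * s * ‖y‖ ^ 2 := by
  have hT0 : (0 : ℝ) < T := by exact_mod_cast hT
  have hb : b ≠ 0 := by
    rintro rfl
    simpa using h.norm_eq_one
  have : Nontrivial (EuclideanSpace ℝ (Fin N)) := ⟨⟨b, 0, hb⟩⟩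
  rcases eq_or_ne y 0 with rfl | hy
  · simp
  set A : EuclideanSpace ℝ (Fin N) →ₗ[ℝ] EuclideanSpace ℝ (Fin N) :=
    Matrix.toEuclideanLin (sampleCov r) with hA
  have hAsym : A.IsSymmetric := Matrix.isSymmetric_toEuclideanLin_iff.2 (isHermitian_sampleCov r)
  have hAapp : ∀ x, A x = WithLp.toLp 2 (sampleCov r *ᵥ x.ofLp) := fun x => rfl
  have hev := hAsym.hasEigenvalue_iSup_of_finiteDimensional
  obtain ⟨v, hv⟩ := hev.exists_hasEigenvector
  -- The supremum of the Rayleigh quotient is itself an eigenvalue, so it cannot exceed the greatest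
  -- one.
  have hle : (⨆ x : {x : EuclideanSpace ℝ (Fin N) // x ≠ 0},
      RCLike.re ⟪A x, x⟫ / ‖(x : EuclideanSpace ℝ (Fin N))‖ ^ 2 : ℝ) ≤ s := by
    refine h.isGreatest.2 ?_
    refine Module.End.hasEigenvalue_of_hasEigenvector (x := v.ofLp) ⟨?_, ?_⟩
    · rw [Module.End.mem_eigenspace_iff, Matrix.toLin'_apply]
      exact congrArg WithLp.ofLp hv.apply_eq_smul
    · intro h0
      exact hv.2 (by ext i; exact congrFun h0 i)
  have hbdd : BddAbove (Set.range fun x : {x : EuclideanSpace ℝ (Fin N) // x ≠ 0} =>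
      RCLike.re ⟪A x, x⟫ / ‖(x : EuclideanSpace ℝ (Fin N))‖ ^ 2) := by
    refine ⟨‖LinearMap.toContinuousLinearMap A‖, ?_⟩
    rintro _ ⟨⟨x, hx⟩, rfl⟩
    have hx0 : 0 < ‖x‖ := norm_pos_iff.2 hx
    simp only [RCLike.re_to_real]
    rw [div_le_iff₀ (by positivity)]
    calc ⟪A x, x⟫ ≤ ‖A x‖ * ‖x‖ := real_inner_le_norm _ _
      _ ≤ ‖LinearMap.toContinuousLinearMap A‖ * ‖x‖ * ‖x‖ := by
          gcongr
          exact (LinearMap.toContinuousLinearMap A).le_opNorm x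
      _ = _ := by ring
  have h1 := (le_ciSup hbdd ⟨y, hy⟩).trans hle
  have hy0 : 0 < ‖y‖ := norm_pos_iff.2 hy
  simp only [RCLike.re_to_real] at h1
  rw [div_le_iff₀ (by positivity), hAapp, inner_sampleCov_mulVec, inv_mul_le_iff₀ hT0] at h1
  linarith

end PrincipalComponent

/-! ### Quotients and Gram matrices in the limit -/

section Limits

/-- The overlap `⟪β, z⟫` need not converge, so quotients are compared with moving targets instead of
limits. -/
lemma tendsto_div_sub_div {A A' B B' : ℕ → ℝ} {c C : ℝ} (hc : 0 < c)
    (hA : Tendsto (fun n => A n - A' n) atTop (𝓝 0))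
    (hB : Tendsto (fun n => B n - B' n) atTop (𝓝 0))
    (hA' : ∀ᶠ n in atTop, |A' n| ≤ C) (hB' : ∀ᶠ n in atTop, c ≤ B' n) :
    Tendsto (fun n => A n / B n - A' n / B' n) atTop (𝓝 0) := by
  have hBlow : ∀ᶠ n in atTop, c / 2 ≤ B n := by
    filter_upwards [hB.eventually_const_lt (show -(c / 2) < 0 by linarith), hB'] with n h1 h2
    linarith
  have hlim : Tendsto (fun n => |A n - A' n| / (c / 2) + C * |B n - B' n| / (c / 2 * c)) atTop
      (𝓝 0) := by
    have h1 := hA.abs.div_const (c / 2)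
    have h2 := (hB.abs.const_mul C).div_const (c / 2 * c)
    simpa using h1.add h2
  refine squeeze_zero_norm' ?_ hlim
  filter_upwards [hBlow, hA', hB'] with n h1 h2 h3
  have hB0 : 0 < B n := by linarith
  have hB0' : 0 < B' n := by linarith
  have hC : 0 ≤ C := (abs_nonneg _).trans h2
  have h4 : A n / B n - A' n / B' n =
      (A n - A' n) / B n + -(A' n * (B n - B' n) / (B n * B' n)) := by
    field_simp
    ring
  rw [h4, Real.norm_eq_abs]
  refine (abs_add_le _ _).trans ?_
  rw [abs_neg, abs_div, abs_div, abs_mul, abs_mul, abs_of_pos hB0, abs_of_pos hB0']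
  gcongr

/-- Spectral limits for Gram matrices that converge to a rank one perturbation of the identity. -/
lemma gram_leading_eigenpair_tendsto {T : ℕ} {κ : ℕ → ℝ} {κ₀ d : ℝ} (hκ0 : ∀ N, 0 ≤ κ N)
    (hκ : Tendsto κ atTop (𝓝 κ₀)) (hd : 0 < d)
    {x : ℕ → Fin T → ℝ} {f : Fin T → ℝ} (hx : ∀ t, Tendsto (fun N => x N t) atTop (𝓝 (f t)))
    (hf : 0 < ∑ t, f t ^ 2) {K : ℕ → Fin T → Fin T → ℝ}
    (hK : ∀ s t, Tendsto (fun N => K N s t - κ N * (x N s * x N t)) atTop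
      (𝓝 (if s = t then d else 0)))
    {u : ℕ → Fin T → ℝ} {μ : ℕ → ℝ} (hu : ∀ᶠ N in atTop, ∑ t, u N t ^ 2 = μ N)
    (hKu : ∀ᶠ N in atTop, ∀ s, ∑ t, K N s t * u N t = μ N * u N s)
    (hmax : ∀ᶠ N in atTop, ∀ y : Fin T → ℝ,
      ∑ s, (∑ t, K N s t * y t) ^ 2 ≤ μ N * ∑ s, y s * ∑ t, K N s t * y t) :
    Tendsto μ atTop (𝓝 (κ₀ * ∑ t, f t ^ 2 + d)) ∧
    Tendsto (fun N => κ N * (∑ t, x N t * u N t) ^ 2) atTop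
      (𝓝 ((κ₀ * ∑ t, f t ^ 2 + d) * (κ₀ * ∑ t, f t ^ 2))) := by
  set F := ∑ t, f t ^ 2 with hF
  set m := κ₀ * F + d with hm
  have hκ₀ : 0 ≤ κ₀ := ge_of_tendsto' hκ hκ0
  have hm0 : 0 < m := by positivity
  have hKlim : ∀ s t, Tendsto (fun N => K N s t) atTop
      (𝓝 ((if s = t then d else 0) + κ₀ * (f s * f t))) := by
    intro s t
    refine ((hK s t).add (hκ.mul ((hx s).mul (hx t)))).congr fun N => ?_
    ring
  have hKf : ∀ s, Tendsto (fun N => ∑ t, K N s t * f t) atTop (𝓝 (m * f s)) := by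
    intro s
    have h := tendsto_finsetSum Finset.univ fun t _ => (hKlim s t).mul_const (f t)
    convert! h using 2
    simp only [add_mul, Finset.sum_add_distrib, ite_mul, zero_mul, Finset.sum_ite_eq,
      Finset.mem_univ, if_true]
    rw [hm, hF, add_mul, add_comm, mul_assoc, Finset.sum_mul, Finset.mul_sum]
    congr 1
    exact Finset.sum_congr rfl fun t _ => by ring
  have hP : Tendsto (fun N => ∑ s, (∑ t, K N s t * f t) ^ 2) atTop (𝓝 (m ^ 2 * F)) := by
    have h := tendsto_finsetSum Finset.univ fun s _ => (hKf s).pow 2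
    convert! h using 2
    rw [hF, Finset.mul_sum]
    exact Finset.sum_congr rfl fun t _ => by ring
  have hQ : Tendsto (fun N => ∑ s, f s * ∑ t, K N s t * f t) atTop (𝓝 (m * F)) := by
    have h := tendsto_finsetSum Finset.univ fun s _ => (hKf s).const_mul (f s)
    convert! h using 2
    rw [hF, Finset.mul_sum]
    exact Finset.sum_congr rfl fun t _ => by ring
  -- Lower bound for `μ`: testing the maximality inequality on `f`, the top eigenvector of the limit
  -- matrix.
  have hlow : Tendsto (fun N => (∑ s, (∑ t, K N s t * f t) ^ 2) /
      ∑ s, f s * ∑ t, K N s t * f t) atTop (𝓝 m) := by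
    have h := hP.div hQ (by positivity)
    rwa [show m ^ 2 * F / (m * F) = m by field_simp] at h
  have hlow_le : ∀ᶠ N in atTop, (∑ s, (∑ t, K N s t * f t) ^ 2) /
      (∑ s, f s * ∑ t, K N s t * f t) ≤ μ N := by
    filter_upwards [hQ.eventually_const_lt (show 0 < m * F by positivity), hmax] with N h1 h2
    rw [div_le_iff₀ h1]
    exact h2 f
  have hμpos : ∀ᶠ N in atTop, 0 < μ N := by
    filter_upwards [hlow.eventually_const_lt hm0, hlow_le] with N h1 h2
    linarith
  set e : ℕ → ℝ := fun N => ∑ s, ∑ t,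
    |K N s t - κ N * (x N s * x N t) - if s = t then d else 0| with he
  have he0 : Tendsto e atTop (𝓝 0) := by
    have h := tendsto_finsetSum Finset.univ fun (s : Fin T) _ =>
      tendsto_finsetSum Finset.univ fun (t : Fin T) _ =>
        ((hK s t).sub_const (if s = t then d else 0)).abs
    simpa using h
  -- The form of `K` at its eigenvector `u` is `μ²`; replacing `K` by its rank one model costs at
  -- most `e * μ`, as each `|u_s u_t| ≤ μ`.
  have hquad : ∀ᶠ N in atTop,
      |μ N ^ 2 - κ N * (∑ t, x N t * u N t) ^ 2 - d * μ N| ≤ e N * μ N := by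
    filter_upwards [hu, hKu] with N h1 h2
    have h3 : μ N ^ 2 - κ N * (∑ t, x N t * u N t) ^ 2 - d * μ N = ∑ s, ∑ t,
        (K N s t - κ N * (x N s * x N t) - if s = t then d else 0) * (u N s * u N t) := by
      have h4 : ∑ s, ∑ t, K N s t * (u N s * u N t) = μ N ^ 2 := by
        calc ∑ s, ∑ t, K N s t * (u N s * u N t) = ∑ s, u N s * ∑ t, K N s t * u N t := by
              refine Finset.sum_congr rfl fun s _ => ?_
              rw [Finset.mul_sum]
              exact Finset.sum_congr rfl fun t _ => by ring
          _ = μ N * ∑ s, u N s ^ 2 := by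
              rw [Finset.mul_sum]
              exact Finset.sum_congr rfl fun s _ => by rw [h2 s]; ring
          _ = μ N ^ 2 := by rw [h1]; ring
      have h5 : ∑ s, ∑ t, κ N * (x N s * x N t) * (u N s * u N t) =
          κ N * (∑ t, x N t * u N t) ^ 2 := by
        rw [sq, Finset.sum_mul_sum, Finset.mul_sum]
        refine Finset.sum_congr rfl fun s _ => ?_
        rw [Finset.mul_sum]
        exact Finset.sum_congr rfl fun t _ => by ring
      have h6 : ∑ s, ∑ t, (if s = t then d else 0) * (u N s * u N t) = d * μ N := by
        rw [← h1, Finset.mul_sum]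
        refine Finset.sum_congr rfl fun s _ => ?_
        simp [sq]
      simp only [sub_mul, Finset.sum_sub_distrib]
      rw [h4, h5, h6]
    have hbound : ∀ s t, |u N s * u N t| ≤ μ N := by
      intro s t
      have hle : ∀ r, u N r ^ 2 ≤ μ N := fun r => h1 ▸ Finset.single_le_sum
        (f := fun t => u N t ^ 2) (fun _ _ => sq_nonneg _) (Finset.mem_univ r)
      rw [abs_le]
      constructor <;> nlinarith [hle s, hle t, sq_nonneg (u N s + u N t),
        sq_nonneg (u N s - u N t)]
    rw [h3, he, Finset.sum_mul]
    refine (Finset.abs_sum_le_sum_abs _ _).trans (Finset.sum_le_sum fun s _ => ?_)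
    rw [Finset.sum_mul]
    refine (Finset.abs_sum_le_sum_abs _ _).trans (Finset.sum_le_sum fun t _ => ?_)
    rw [abs_mul]
    exact mul_le_mul_of_nonneg_left (hbound s t) (abs_nonneg _)
  -- Upper bound for `μ`: Cauchy–Schwarz in the quadratic identity, followed by division by `μ > 0`.
  have hup : ∀ᶠ N in atTop, μ N ≤ κ N * ∑ t, x N t ^ 2 + d + e N := by
    filter_upwards [hquad, hμpos, hu] with N h1 h2 h3
    have h4 := Finset.sum_mul_sq_le_sq_mul_sq Finset.univ (x N) (u N)
    rw [h3] at h4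
    have h5 := (abs_le.1 h1).2
    have h6 := mul_le_mul_of_nonneg_left h4 (hκ0 N)
    have h7 : μ N * μ N ≤ (κ N * ∑ t, x N t ^ 2 + d + e N) * μ N := by nlinarith
    exact le_of_mul_le_mul_right h7 h2
  have hup_lim : Tendsto (fun N => κ N * ∑ t, x N t ^ 2 + d + e N) atTop (𝓝 m) := by
    have h := ((hκ.mul (tendsto_finsetSum Finset.univ fun t _ => (hx t).pow 2)).add_const d).add he0
    simpa [hm, hF] using h
  have hμ : Tendsto μ atTop (𝓝 m) := tendsto_of_tendsto_of_tendsto_of_le_of_le' hlow hup_lim hlow_le hup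
  refine ⟨hμ, ?_⟩
  have hdiff : Tendsto (fun N => μ N ^ 2 - κ N * (∑ t, x N t * u N t) ^ 2 - d * μ N) atTop
      (𝓝 0) := by
    refine squeeze_zero_norm' hquad ?_
    simpa using he0.mul hμ
  have h := ((hμ.pow 2).sub (hμ.const_mul d)).sub hdiff
  rw [show m ^ 2 - d * m - 0 = m * (κ₀ * F) by rw [hm]; ring] at h
  refine h.congr fun N => ?_
  ring

end Limits

/-! ### Limits of the PCA estimates -/

section LeadingComponent

/-- Limits of the leading sample principal component in a one-factor model, along a fixed
realization of the returns. -/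
lemma isPCA_limits {T : ℕ} (hT : 1 ≤ T) {κ₀ d : ℝ} (hd : 0 < d) {σ : ℕ → ℝ}
    (hσ : ∀ N, 0 < σ N) (hκ : Tendsto (fun N : ℕ => σ N ^ 2 / N) atTop (𝓝 κ₀))
    {β z : ∀ N : ℕ, EuclideanSpace ℝ (Fin N)}
    {r : ∀ N : ℕ, Fin T → EuclideanSpace ℝ (Fin N)} {f : Fin T → ℝ}
    (hf : 0 < ∑ t, f t ^ 2)
    (hx : ∀ t, Tendsto (fun N => ⟪β N, r N t⟫ / σ N) atTop (𝓝 (f t)))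
    (hG : ∀ s t, Tendsto (fun N : ℕ => (⟪r N s, r N t⟫ - ⟪β N, r N s⟫ * ⟪β N, r N t⟫) / N) atTop
      (𝓝 (if s = t then d else 0)))
    (hz : ∀ t, Tendsto (fun N : ℕ => ⟪z N - ⟪β N, z N⟫ • β N, r N t⟫ / √(N : ℝ)) atTop (𝓝 0))
    {s : ℕ → ℝ} {b : ∀ N : ℕ, EuclideanSpace ℝ (Fin N)}
    (hPCA : ∀ᶠ N in atTop, IsPCA (sampleCov (r N)) (s N) (b N)) :
    Tendsto (fun N : ℕ => T * s N / N) atTop (𝓝 (κ₀ * ∑ t, f t ^ 2 + d)) ∧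
    Tendsto (fun N => ⟪β N, b N⟫ ^ 2) atTop
      (𝓝 (κ₀ * (∑ t, f t ^ 2) / (κ₀ * ∑ t, f t ^ 2 + d))) ∧
    Tendsto (fun N => ⟪b N, z N⟫ - ⟪β N, z N⟫ * ⟪β N, b N⟫) atTop (𝓝 0) := by
  set F := ∑ t, f t ^ 2 with hF
  have hκ0 : ∀ N : ℕ, 0 ≤ σ N ^ 2 / N := fun N => by positivity
  have hκ₀ : 0 ≤ κ₀ := ge_of_tendsto' hκ hκ0
  have hm0 : 0 < κ₀ * F + d := by positivity
  have hgood : ∀ᶠ N : ℕ in atTop, 1 ≤ N ∧ IsPCA (sampleCov (r N)) (s N) (b N) :=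
    (eventually_ge_atTop 1).and hPCA
  -- These scores form a Gram eigenvector for `T s / N`, normalized so that the squared length is
  -- the eigenvalue.
  set u : ℕ → Fin T → ℝ := fun N t => ⟪r N t, b N⟫ / √(N : ℝ) with hu
  have hμeq : ∀ᶠ N : ℕ in atTop, ∑ t, u N t ^ 2 = T * s N / N := by
    filter_upwards [hgood] with N ⟨_, h⟩
    have h1 := congrArg (fun v => ⟪v, b N⟫) (h.sum_inner_smul hT)
    simp only [sum_inner, real_inner_smul_left, real_inner_self_eq_norm_sq, h.norm_eq_one] at h1
    simp only [hu, div_pow, Real.sq_sqrt (Nat.cast_nonneg N), ← Finset.sum_div]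
    simp only [sq, h1, mul_one]
  obtain ⟨hμ, hproj⟩ := gram_leading_eigenpair_tendsto (κ := fun N : ℕ => σ N ^ 2 / N) hκ0 hκ hd
    (x := fun N t => ⟪β N, r N t⟫ / σ N) hx hf (K := fun N s t => ⟪r N s, r N t⟫ / N)
    (u := u) (μ := fun N : ℕ => T * s N / N) (fun s t => by
      refine (hG s t).congr fun N => ?_
      have := (hσ N).ne'
      field_simp) hμeq (by
      filter_upwards [hgood] with N ⟨_, h⟩ t
      have h1 := congrArg (fun v => ⟪r N t, v⟫) (h.sum_inner_smul hT)
      simp only [inner_sum, real_inner_smul_right] at h1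
      calc ∑ t', ⟪r N t, r N t'⟫ / N * u N t'
          = (∑ t', ⟪r N t', b N⟫ * ⟪r N t, r N t'⟫) / (N * √(N : ℝ)) := by
            rw [Finset.sum_div]
            refine Finset.sum_congr rfl fun t' _ => ?_
            rw [hu]
            ring
        _ = _ := by
            rw [h1, hu]
            ring) (by
      filter_upwards [hgood] with N ⟨hN, h⟩ y
      have hN0 : (0 : ℝ) < N := by exact_mod_cast hN
      -- On combinations of returns the Rayleigh bound becomes `‖K y‖² ≤ μ ⟪y, K y⟫`.
      have h1 := h.sum_inner_sq_le hT (∑ t, y t • r N t)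
      rw [← real_inner_self_eq_norm_sq, sum_inner] at h1
      simp only [real_inner_smul_left] at h1
      simp only [inner_sum, real_inner_smul_right] at h1
      have h2 : ∀ s : Fin T, ∑ t, ⟪r N s, r N t⟫ / N * y t =
          (∑ t, y t * ⟪r N s, r N t⟫) / N := fun s => by
        rw [Finset.sum_div]
        exact Finset.sum_congr rfl fun t _ => by ring
      simp only [h2, div_pow, mul_div_assoc', ← Finset.sum_div]
      rw [div_mul_eq_mul_div, div_div, sq (N : ℝ)]
      gcongr)
  refine ⟨hμ, ?_, ?_⟩
  · have h := hproj.div (hμ.pow 2) (by positivity)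
    rw [show (κ₀ * F + d) * (κ₀ * F) / (κ₀ * F + d) ^ 2 = κ₀ * F / (κ₀ * F + d) by
      field_simp] at h
    refine h.congr' ?_
    filter_upwards [hgood, hμ.eventually_const_lt hm0] with N ⟨hN, hp⟩ hpos
    have hN0 : (0 : ℝ) < N := by exact_mod_cast hN
    have hσ0 := (hσ N).ne'
    have h1 := congrArg (fun v => ⟪β N, v⟫) (hp.sum_inner_smul hT)
    simp only [inner_sum, real_inner_smul_right] at h1
    have h2 : ∑ t, ⟪β N, r N t⟫ / σ N * u N t =
        T * s N * ⟪β N, b N⟫ / (σ N * √(N : ℝ)) := by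
      rw [← h1, Finset.sum_div]
      refine Finset.sum_congr rfl fun t _ => ?_
      rw [hu]
      ring
    have hs0 : (T : ℝ) * s N ≠ 0 := fun h0 => by
      rw [h0, zero_div] at hpos
      exact hpos.false
    have hs1 := right_ne_zero_of_mul hs0
    simp only [Pi.div_apply]
    rw [h2]
    rw [div_pow, mul_pow _ (√(N : ℝ)), Real.sq_sqrt hN0.le]
    field_simp
  · have hlim : Tendsto (fun N : ℕ => (∑ t, |⟪z N - ⟪β N, z N⟫ • β N, r N t⟫ / √(N : ℝ)|) *
        ((T * s N / N + 1) / (T * s N / N))) atTop (𝓝 0) := by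
      have h1 := tendsto_finsetSum Finset.univ fun (t : Fin T) _ => (hz t).abs
      have h2 := h1.mul ((hμ.add_const 1).div hμ hm0.ne')
      simpa using h2
    refine squeeze_zero_norm' ?_ hlim
    filter_upwards [hgood, hμ.eventually_const_lt hm0, hμeq] with N ⟨hN, hp⟩ hpos hsum
    have hN0 : (0 : ℝ) < N := by exact_mod_cast hN
    have h1 := congrArg (fun v => ⟪z N - ⟪β N, z N⟫ • β N, v⟫) (hp.sum_inner_smul hT)
    simp only [inner_sum, real_inner_smul_right] at h1
    set w := z N - ⟪β N, z N⟫ • β N with hw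
    have h2 : ⟪b N, z N⟫ - ⟪β N, z N⟫ * ⟪β N, b N⟫ = ⟪w, b N⟫ := by
      rw [hw, inner_sub_left, real_inner_smul_left, real_inner_comm (z N) (b N)]
    have hsN : √(N : ℝ) * √(N : ℝ) = N := Real.mul_self_sqrt hN0.le
    have h3 : T * s N / N * ⟪w, b N⟫ = ∑ t, u N t * (⟪w, r N t⟫ / √(N : ℝ)) := by
      rw [div_mul_eq_mul_div, ← h1, Finset.sum_div]
      refine Finset.sum_congr rfl fun t _ => ?_
      rw [hu]
      simp only
      rw [div_mul_div_comm, hsN]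
    set m := T * s N / N with hm
    -- A crude bound from `2 |u| ≤ 1 + u²` and `u² ≤ m`, which avoids a square root.
    have hub : ∀ t, |u N t| ≤ m + 1 := by
      intro t
      have h4 : u N t ^ 2 ≤ m := hsum ▸ Finset.single_le_sum
        (f := fun t => u N t ^ 2) (fun _ _ => sq_nonneg _) (Finset.mem_univ t)
      exact abs_le.2 ⟨by nlinarith [sq_nonneg (u N t + 1)], by nlinarith [sq_nonneg (u N t - 1)]⟩
    rw [h2, Real.norm_eq_abs, mul_div_assoc', le_div_iff₀ hpos, mul_comm, ← abs_of_pos hpos,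
      ← abs_mul, h3, abs_of_pos hpos, Finset.sum_mul]
    refine (Finset.abs_sum_le_sum_abs _ _).trans (Finset.sum_le_sum fun t _ => ?_)
    rw [abs_mul, mul_comm]
    exact mul_le_mul_of_nonneg_left (hub t) (abs_nonneg _)

/-- A nonnegative exposure to the dispersionless vector fixes the sign of the estimated factor. -/
lemma tendsto_of_sq_tendsto_of_oriented {p h γ : ℕ → ℝ} {φ a : ℝ} (hφ : 0 < φ) (ha : 0 < a)
    (hp : Tendsto (fun N => p N ^ 2) atTop (𝓝 (φ ^ 2)))
    (hh : Tendsto (fun N => h N - γ N * p N) atTop (𝓝 0))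
    (hh0 : ∀ᶠ N in atTop, 0 ≤ h N) (hγ : ∀ᶠ N in atTop, a ≤ γ N) :
    Tendsto p atTop (𝓝 φ) := by
  have habs : Tendsto (fun N => |p N|) atTop (𝓝 φ) := by
    have := hp.sqrt
    simpa [Real.sqrt_sq_eq_abs, abs_of_pos hφ] using this
  refine habs.congr' ?_
  filter_upwards [habs.eventually_const_lt (half_lt_self hφ), hh0, hγ,
    hh.eventually_lt_const (show 0 < a * (φ / 2) by positivity)] with N h1 h2 h3 h4
  refine abs_of_nonneg ?_
  -- A negative `p` would be below `-φ / 2`, forcing `h - γ p ≥ a φ / 2` and contradicting its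
  -- convergence to zero.
  by_contra! hneg
  rw [abs_of_neg hneg] at h1
  nlinarith

end LeadingComponent

/-! ### Limits of the exposure formula -/

section PortfolioLimits

variable {γ h p ρ : ℕ → ℝ} {φ : ℝ}

lemma tendsto_mul_sq_sub (hγ : ∀ᶠ N in atTop, |γ N| ≤ 1)
    (hh : Tendsto (fun N => h N - φ * γ N) atTop (𝓝 0)) (hρ : Tendsto ρ atTop (𝓝 1)) :
    Tendsto (fun N => (1 - ρ N * h N ^ 2) - (1 - φ ^ 2 * γ N ^ 2)) atTop (𝓝 0) := by
  have hbdd : ∀ {X : ℕ → ℝ}, Tendsto X atTop (𝓝 0) →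
      Tendsto (fun N => γ N * X N) atTop (𝓝 0) := by
    intro X hX
    refine squeeze_zero_norm' ?_ (tendsto_zero_iff_norm_tendsto_zero.1 hX)
    filter_upwards [hγ] with N hN
    rw [norm_mul]
    exact mul_le_of_le_one_left (norm_nonneg _) hN
  have hρ' : Tendsto (fun N => 1 - ρ N) atTop (𝓝 0) := by
    simpa using hρ.const_sub 1
  have h1 := (hbdd (hbdd hρ')).const_mul (φ ^ 2)
  have h2 := hρ.mul ((hh.pow 2).add ((hbdd hh).const_mul (2 * φ)))
  have h3 := h1.sub h2
  simp only [mul_zero, ne_eq, OfNat.ofNat_ne_zero, not_false_eq_true, zero_pow, add_zero,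
    sub_zero] at h3
  refine h3.congr fun N => ?_
  ring

lemma tendsto_mul_mul_sub (hγ : ∀ᶠ N in atTop, |γ N| ≤ 1)
    (hh : Tendsto (fun N => h N - φ * γ N) atTop (𝓝 0)) (hp : Tendsto p atTop (𝓝 φ))
    (hρ : Tendsto ρ atTop (𝓝 1)) :
    Tendsto (fun N => (γ N - ρ N * h N * p N) - γ N * (1 - φ ^ 2)) atTop (𝓝 0) := by
  have hρp : Tendsto (fun N => φ - ρ N * p N) atTop (𝓝 0) := by
    simpa using (hρ.mul hp).const_sub φ
  have h1 : Tendsto (fun N => γ N * (φ - ρ N * p N)) atTop (𝓝 0) := by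
    refine squeeze_zero_norm' ?_ (tendsto_zero_iff_norm_tendsto_zero.1 hρp)
    filter_upwards [hγ] with N hN
    rw [norm_mul]
    exact mul_le_of_le_one_left (norm_nonneg _) hN
  have h3 := (h1.const_mul φ).sub ((hρ.mul hp).mul hh)
  simp only [mul_zero, sub_zero] at h3
  refine h3.congr fun N => ?_
  ring

lemma one_sub_sq_le {g : ℝ} (hg : |g| ≤ 1) :
    1 - φ ^ 2 ≤ 1 - φ ^ 2 * g ^ 2 := by
  have : g ^ 2 ≤ 1 := by
    rw [← sq_abs]
    nlinarith [abs_nonneg g]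
  nlinarith [sq_nonneg φ]

/-- The common limit of the error term and of the rescaled factor exposure of the estimated
minimum variance portfolio. -/
lemma tendsto_exposure_sub (hφ1 : φ ^ 2 < 1) (hγ : ∀ᶠ N in atTop, |γ N| ≤ 1)
    (hh : Tendsto (fun N => h N - φ * γ N) atTop (𝓝 0)) (hp : Tendsto p atTop (𝓝 φ))
    (hρ : Tendsto ρ atTop (𝓝 1)) :
    Tendsto (fun N => (γ N - ρ N * h N * p N) / (1 - ρ N * h N ^ 2) -
      γ N * (1 - φ ^ 2) / (1 - φ ^ 2 * γ N ^ 2)) atTop (𝓝 0) := by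
  refine tendsto_div_sub_div (c := 1 - φ ^ 2) (C := 1) (by linarith)
    (tendsto_mul_mul_sub hγ hh hp hρ) (tendsto_mul_sq_sub hγ hh hρ) ?_ ?_
  · filter_upwards [hγ] with N hN
    rw [abs_mul, abs_of_pos (show 0 < 1 - φ ^ 2 by linarith)]
    nlinarith [sq_nonneg φ, abs_nonneg (γ N)]
  · filter_upwards [hγ] with N hN
    exact one_sub_sq_le hN

/-- The denominator lies in `(0, 1]`, so dividing by it can only increase the numerator. -/
lemma le_exposure_limit (hφ1 : φ ^ 2 < 1) {a g : ℝ} (ha : 0 < a) (hag : a ≤ g)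
    (hg : |g| ≤ 1) : a * (1 - φ ^ 2) ≤ g * (1 - φ ^ 2) / (1 - φ ^ 2 * g ^ 2) := by
  have h1 := one_sub_sq_le (φ := φ) hg
  have h2 : 1 - φ ^ 2 * g ^ 2 ≤ 1 := by nlinarith [mul_nonneg (sq_nonneg φ) (sq_nonneg g)]
  rw [le_div_iff₀ (by linarith)]
  have h3 : 0 ≤ a * (1 - φ ^ 2) := mul_nonneg ha.le (by linarith)
  have h4 : a * (1 - φ ^ 2) ≤ g * (1 - φ ^ 2) :=
    mul_le_mul_of_nonneg_right hag (by linarith)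
  nlinarith

/-- The shrinkage weight tends to `1` because the factor variance grows like `N` while the specific
variance is `o(N)`. -/
lemma tendsto_div_add_one {q e : ℕ → ℝ} {q₀ : ℝ} (hq₀ : 0 < q₀)
    (hq : Tendsto (fun N : ℕ => q N / N) atTop (𝓝 q₀))
    (he : Tendsto (fun N : ℕ => e N / N) atTop (𝓝 0)) :
    Tendsto (fun N => q N / (q N + e N)) atTop (𝓝 1) := by
  have h := hq.div (hq.add he) (by linarith)
  rw [add_zero, div_self hq₀.ne'] at h
  refine h.congr' ?_
  filter_upwards [eventually_ge_atTop 1] with N hN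
  have hN0 : (N : ℝ) ≠ 0 := by positivity
  simp only [Pi.div_apply]
  rw [← add_div, div_div_div_cancel_right₀ hN0]

lemma isEquivalent_of_tendsto_sub {u v : ℕ → ℝ} {c : ℝ} (hc : 0 < c)
    (h : Tendsto (fun N => u N - v N) atTop (𝓝 0)) (hv : ∀ᶠ N in atTop, c ≤ v N) :
    Asymptotics.IsEquivalent atTop u v := by
  have h1 : (fun N => u N - v N) =o[atTop] (fun _ => (1 : ℝ)) :=
    (Asymptotics.isLittleO_one_iff ℝ).2 h
  refine h1.trans_isBigO (Asymptotics.IsBigO.of_bound c⁻¹ ?_)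
  filter_upwards [hv] with N hN
  rw [norm_one, Real.norm_eq_abs, abs_of_pos (hc.trans_le hN), inv_mul_eq_div, le_div_iff₀ hc]
  linarith

end PortfolioLimits

/-! ### The constant `Ψ` -/

section Psi

variable {T : ℕ} {c₁ δ : ℝ} {f : Fin T → ℝ}

lemma one_lt_psi (hT : 1 ≤ T) (hc₁ : 0 < c₁) (hδ : 0 < δ) (hf : 0 < ∑ t, f t ^ 2) :
    1 < psi c₁ δ f := by
  have hT0 : (0 : ℝ) < T := by exact_mod_cast hT
  have hxi : 0 < xi f := by rw [xi]; positivity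
  rw [psi, Real.lt_sqrt zero_le_one]
  have : 0 < δ ^ 2 * c₁ / xi f := by positivity
  linarith

/-- Identifies the spectral limit of the squared cosine: `κ₀ F = ξ / c₁` when `κ₀ = (T c₁)⁻¹`. -/
lemma inv_psi_sq (hT : 1 ≤ T) (hc₁ : 0 < c₁) (hδ : 0 < δ) (hf : 0 < ∑ t, f t ^ 2) :
    (psi c₁ δ f)⁻¹ ^ 2 =
      (T * c₁)⁻¹ * (∑ t, f t ^ 2) / ((T * c₁)⁻¹ * ∑ t, f t ^ 2 + δ ^ 2) := by
  have hT0 : (0 : ℝ) < T := by exact_mod_cast hT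
  rw [psi, inv_pow, xi, Real.sq_sqrt (by positivity)]
  field_simp

end Psi

/-! ### Tracking error and variance forecast ratio -/

section PortfolioPerformance

variable {β b : ∀ N : ℕ, EuclideanSpace ℝ (Fin N)} {σ : ℕ → ℝ} {κ₀ d : ℝ}

/-- The exposure of the optimal portfolio to the true factor is asymptotically negligible. -/
lemma tendsto_exposure_wstar (hβ : ∀ N, 1 ≤ N → ‖β N‖ = 1) {b₀ : ℝ} (hb₀ : b₀ < 1)
    (hγ : ∀ᶠ N in atTop, 0 ≤ ⟪β N, zVec N⟫ ∧ ⟪β N, zVec N⟫ ≤ b₀)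
    (hκ₀ : 0 < κ₀) (hd : 0 < d) (hκ : Tendsto (fun N : ℕ => σ N ^ 2 / N) atTop (𝓝 κ₀))
    {w : ∀ N : ℕ, Fin N → ℝ}
    (hw : ∀ᶠ N in atTop, IsMinVar (factorCov (σ N ^ 2) (β N) d) (w N)) :
    Tendsto (fun N : ℕ => √(N : ℝ) * ⟪β N, WithLp.toLp 2 (w N)⟫) atTop (𝓝 0) := by
  set γ : ℕ → ℝ := fun N => ⟪β N, zVec N⟫ with hγdef
  have hγ1 : ∀ᶠ N in atTop, |γ N| ≤ 1 := by
    filter_upwards [hγ] with N ⟨h1, h2⟩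
    rw [abs_of_nonneg h1]
    linarith
  have hρ : Tendsto (fun N => σ N ^ 2 / (σ N ^ 2 + d)) atTop (𝓝 1) :=
    tendsto_div_add_one hκ₀ hκ (tendsto_const_nhds.div_atTop tendsto_natCast_atTop_atTop)
  -- The true portfolio is the case `b = β`, `p = φ = 1`. The model numerator is then exactly zero,
  -- whence `C = 0` below, and `γ ≤ b₀ < 1` keeps the denominator positive.
  have hh : Tendsto (fun N => γ N - 1 * γ N) atTop (𝓝 0) := by simp
  have hnum := tendsto_mul_mul_sub (p := fun _ => 1) hγ1 hh tendsto_const_nhds hρ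
  have hden := tendsto_mul_sq_sub hγ1 hh hρ
  have h := tendsto_div_sub_div (c := 1 - b₀) (C := 0) (by linarith) hnum hden
    (Eventually.of_forall fun N => by simp) (by
      filter_upwards [hγ] with N ⟨h1, h2⟩
      have : γ N ^ 2 ≤ b₀ := by
        rw [hγdef]
        nlinarith
      linarith)
  refine h.congr' ?_
  filter_upwards [eventually_ge_atTop 1, hw] with N hN hwN
  rw [(hwN.inner_eq hN (sq_nonneg _) hd (hβ N hN)).2.1, real_inner_self_eq_norm_sq, hβ N hN]
  simp [hγdef]

/-- Asymptotic performance of the minimum variance portfolio built from an estimated factor whose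
overlaps with the true factor and with the dispersionless vector are known in the limit. -/
lemma portfolio_performance (hβ : ∀ N, 1 ≤ N → ‖β N‖ = 1) {a b₀ φ : ℝ} (ha : 0 < a)
    (hb₀ : b₀ < 1) (hγ : ∀ᶠ N in atTop, a ≤ ⟪β N, zVec N⟫ ∧ ⟪β N, zVec N⟫ ≤ b₀)
    (hκ₀ : 0 < κ₀) (hd : 0 < d) (hκ : Tendsto (fun N : ℕ => σ N ^ 2 / N) atTop (𝓝 κ₀))
    {wstar : ∀ N : ℕ, Fin N → ℝ}
    (hwstar : ∀ᶠ N in atTop, IsMinVar (factorCov (σ N ^ 2) (β N) d) (wstar N))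
    (hφ1 : φ ^ 2 < 1) (hb : ∀ᶠ N in atTop, ‖b N‖ = 1)
    (hp : Tendsto (fun N => ⟪β N, b N⟫) atTop (𝓝 φ))
    (hh : Tendsto (fun N => ⟪b N, zVec N⟫ - φ * ⟪β N, zVec N⟫) atTop (𝓝 0))
    {s e : ℕ → ℝ} {q₀ C : ℝ} (hq₀ : 0 < q₀)
    (hs : Tendsto (fun N : ℕ => s N / N) atTop (𝓝 q₀)) (he : ∀ᶠ N in atTop, 0 < e N)
    (heC : ∀ᶠ N in atTop, e N ≤ C) {what : ∀ N : ℕ, Fin N → ℝ}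
    (hwhat : ∀ᶠ N in atTop, IsMinVar (factorCov (s N) (b N) (e N)) (what N)) :
    (∃ c : ℝ, 0 < c ∧ ∀ᶠ N in atTop,
      c ≤ trackingErrorSq (factorCov (σ N ^ 2) (β N) d) (wstar N) (what N)) ∧
    Tendsto (fun N => varForecastRatio (factorCov (σ N ^ 2) (β N) d)
      (factorCov (s N) (b N) (e N)) (what N)) atTop (𝓝 0) := by
  have hγ1 : ∀ᶠ N in atTop, |⟪β N, zVec N⟫| ≤ 1 := by
    filter_upwards [hγ] with N ⟨h1, h2⟩
    rw [abs_of_pos (ha.trans_le h1)]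
    linarith
  have heN : Tendsto (fun N : ℕ => e N / N) atTop (𝓝 0) := by
    refine squeeze_zero' ?_ ?_ (tendsto_const_nhds.div_atTop tendsto_natCast_atTop_atTop :
      Tendsto (fun N : ℕ => C / (N : ℝ)) atTop (𝓝 0))
    · filter_upwards [he] with N h
      positivity
    · filter_upwards [heC] with N h
      gcongr
  have hρ := tendsto_div_add_one hq₀ hs heN
  have hs0 : ∀ᶠ N : ℕ in atTop, 1 ≤ N ∧ 0 ≤ s N := by
    filter_upwards [eventually_ge_atTop 1, hs.eventually_const_lt hq₀] with N hN h
    have hN0 : (0 : ℝ) < N := by exact_mod_cast hN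
    refine ⟨hN, ?_⟩
    rw [lt_div_iff₀ hN0, zero_mul] at h
    exact h.le
  set ℓ : ℝ := a * (1 - φ ^ 2) with hℓ
  have hℓ0 : 0 < ℓ := mul_pos ha (by linarith)
  have hexp := tendsto_exposure_sub hφ1 hγ1 hh hp hρ
  have hwhat_low : ∀ᶠ N : ℕ in atTop, ℓ / 2 ≤ √(N : ℝ) * ⟪β N, WithLp.toLp 2 (what N)⟫ := by
    filter_upwards [hs0, hwhat, he, hb, hγ, hγ1,
      hexp.eventually_const_lt (show -(ℓ / 2) < 0 by linarith)] with N ⟨hN, hsN⟩ h1 h2 h3 h4 h5 h6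
    rw [(h1.inner_eq hN hsN h2 h3).2.1]
    have := le_exposure_limit hφ1 ha h4.1 h5
    linarith
  have hstar := tendsto_exposure_wstar hβ hb₀ (hγ.mono fun N h => ⟨ha.le.trans h.1, h.2⟩) hκ₀ hd hκ
    hwstar
  have hκlow : ∀ᶠ N : ℕ in atTop, κ₀ / 2 ≤ σ N ^ 2 / N :=
    (hκ.eventually_const_lt (half_lt_self hκ₀)).mono fun _ h => h.le
  have hport : ∀ (N : ℕ) (_ : 1 ≤ N) (w : EuclideanSpace ℝ (Fin N)),
      σ N ^ 2 / N * (√(N : ℝ) * ⟪β N, w⟫) ^ 2 ≤ portVar (factorCov (σ N ^ 2) (β N) d) w.ofLp := by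
    intro N hN w
    have hN0 : (0 : ℝ) < N := by exact_mod_cast hN
    rw [portVar_factorCov, mul_pow, Real.sq_sqrt hN0.le,
      show σ N ^ 2 / N * (N * ⟪β N, w⟫ ^ 2) = σ N ^ 2 * ⟪β N, w⟫ ^ 2 by field_simp]
    have : 0 ≤ d * ‖w‖ ^ 2 := by positivity
    linarith
  constructor
  -- Eventually the rescaled exposures are at least `ℓ / 2` for `ŵ` and below `ℓ / 4` for `w_*`,
  -- leaving a gap of `ℓ / 4`.
  · refine ⟨κ₀ / 2 * (ℓ / 4) ^ 2, by positivity, ?_⟩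
    filter_upwards [hs0, hwhat_low, hκlow,
      hstar.eventually_lt_const (show 0 < ℓ / 4 by linarith)] with N ⟨hN, _⟩ h1 h2 h3
    refine le_trans ?_ (hport N hN (WithLp.toLp 2 (wstar N - what N)))
    rw [WithLp.toLp_sub, inner_sub_right, mul_sub]
    refine mul_le_mul h2 ?_ (by positivity) (by positivity)
    rw [← neg_sq (√(N : ℝ) * ⟪β N, WithLp.toLp 2 (wstar N)⟫ - _)]
    exact pow_le_pow_left₀ (by positivity) (by linarith) 2
  · have hden := tendsto_mul_sq_sub hγ1 hh hρ
    have hlim : Tendsto (fun N : ℕ => e N / N / ((1 - φ ^ 2) / 2) / (κ₀ / 2 * (ℓ / 2) ^ 2)) atTop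
        (𝓝 0) := by
      simpa using (heN.div_const ((1 - φ ^ 2) / 2)).div_const (κ₀ / 2 * (ℓ / 2) ^ 2)
    have hbound : ∀ᶠ N : ℕ in atTop,
        0 ≤ portVar (factorCov (s N) (b N) (e N)) (what N) ∧
        portVar (factorCov (s N) (b N) (e N)) (what N) ≤ e N / N / ((1 - φ ^ 2) / 2) ∧
        κ₀ / 2 * (ℓ / 2) ^ 2 ≤ portVar (factorCov (σ N ^ 2) (β N) d) (what N) := by
      filter_upwards [hs0, hwhat, he, hb, hγ1, hwhat_low, hκlow,
        hden.eventually_const_lt (show -((1 - φ ^ 2) / 2) < 0 by linarith)]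
        with N ⟨hN, hsN⟩ h1 h2 h3 h4 h5 h6 h7
      obtain ⟨h8, -, h9⟩ := h1.inner_eq hN hsN h2 h3
      have h10 := one_sub_sq_le (φ := φ) h4
      have h11 : 0 < (1 - φ ^ 2) / 2 := by linarith
      refine ⟨?_, ?_, ?_⟩
      · rw [h9]
        positivity
      · rw [h9]
        exact div_le_div_of_nonneg_left (by positivity) h11 (by linarith)
      · refine le_trans ?_ (hport N hN (WithLp.toLp 2 (what N)))
        exact mul_le_mul h6 (pow_le_pow_left₀ (by positivity) h5 2) (by positivity) (by positivity)
    refine squeeze_zero' ?_ ?_ hlim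
    · filter_upwards [hbound] with N ⟨h1, _, h3⟩
      have : 0 < κ₀ / 2 * (ℓ / 2) ^ 2 := by positivity
      exact div_nonneg h1 (this.le.trans h3)
    · filter_upwards [hbound] with N ⟨h1, h2, h3⟩
      exact div_le_div₀ (h1.trans h2) h2 (by positivity) h3

end PortfolioPerformance

/-! ### The error term and elementary geometry -/

section ErrorTerm

lemma cos_angle_of_norm_eq_one {E : Type*} [NormedAddCommGroup E] [InnerProductSpace ℝ E]
    {x y : E} (hx : ‖x‖ = 1) (hy : ‖y‖ = 1) :
    Real.cos (InnerProductGeometry.angle x y) = ⟪x, y⟫ := by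
  rw [InnerProductGeometry.cos_angle, hx, hy]
  simp

/-- The factors `1 *` put the expression in the shape of `tendsto_exposure_sub` with `ρ = 1`. -/
lemma errorTerm_eq {N : ℕ} (hN : 1 ≤ N) {β b : EuclideanSpace ℝ (Fin N)} (hb : ‖b‖ = 1) :
    errorTerm β b =
      (⟪β, zVec N⟫ - 1 * ⟪b, zVec N⟫ * ⟪β, b⟫) / (1 - 1 * ⟪b, zVec N⟫ ^ 2) := by
  rw [errorTerm, Real.sin_sq, cos_angle_of_norm_eq_one hb (norm_zVec hN), one_mul, one_mul,
    mul_comm ⟪β, b⟫]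

lemma norm_sub_inner_smul_le {E : Type*} [NormedAddCommGroup E] [InnerProductSpace ℝ E]
    {x z : E} (hx : ‖x‖ = 1) (hz : ‖z‖ = 1) : ‖z - ⟪x, z⟫ • x‖ ≤ 1 := by
  have h : ‖z - ⟪x, z⟫ • x‖ ^ 2 = 1 - ⟪x, z⟫ ^ 2 := by
    rw [norm_sub_sq_real, norm_smul, mul_pow, hx, hz, real_inner_smul_right, real_inner_comm x z,
      Real.norm_eq_abs, sq_abs]
    ring
  have h2 : ‖z - ⟪x, z⟫ • x‖ ^ 2 ≤ 1 := by nlinarith [sq_nonneg ⟪x, z⟫]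
  exact (sq_le_one_iff₀ (norm_nonneg _)).1 h2

lemma inner_sub_inner_smul_self {E : Type*} [NormedAddCommGroup E] [InnerProductSpace ℝ E]
    {x z : E} (hx : ‖x‖ = 1) : ⟪z - ⟪x, z⟫ • x, x⟫ = 0 := by
  rw [inner_sub_left, real_inner_smul_left, real_inner_self_eq_norm_sq, hx, real_inner_comm x z]
  ring

end ErrorTerm

end DispersionBias

/-! ### Assembly of the four limits -/

theorem mainTheorem3 {Ω : Type*} [MeasurableSpace Ω] (P : Measure Ω) [IsProbabilityMeasure P]
    -- number of observations, specific volatility, factor volatilities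
    (T : ℕ) (hT : 1 ≤ T) (c₁ δ : ℝ) (hc₁ : 0 < c₁) (hδ : 0 < δ)
    (σ : ℕ → ℝ) (hσ : ∀ N, 0 < σ N)
    (hσc₁ : Tendsto (fun N : ℕ => (N : ℝ) / (T * σ N ^ 2)) atTop (𝓝 c₁))
    -- factor exposures
    (β : ∀ N : ℕ, EuclideanSpace ℝ (Fin N)) (hβ : ∀ N, 1 ≤ N → ‖β N‖ = 1)
    (hβz : ∃ a b : ℝ, 0 < a ∧ b < 1 ∧
      ∀ᶠ N in atTop, a ≤ ⟪β N, zVec N⟫ ∧ ⟪β N, zVec N⟫ ≤ b)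
    -- for each `N`, i.i.d. Gaussian returns with the one-factor covariance
    (R : ∀ N : ℕ, Fin T → Ω → EuclideanSpace ℝ (Fin N))
    (hRindep : ∀ N, iIndepFun (R N) P)
    (hRlaw : ∀ N t, HasLaw (R N t)
      (multivariateGaussian 0 (factorCov (σ N ^ 2) (β N) (δ ^ 2))) P)
    -- the standardized factor components of the returns converge as `N → ∞`
    (f : Fin T → Ω → ℝ) (hfindep : iIndepFun f P) (hflaw : ∀ t, HasLaw (f t) (gaussianReal 0 1) P)
    (hRf : ∀ t, ∀ᵐ ω ∂P, Tendsto (fun N : ℕ => ⟪β N, R N t ω⟫ / σ N) atTop (𝓝 (f t ω)))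
    -- PCA estimates of factor variance and exposures, and an estimator of the specific risk
    (σsqhat : ℕ → Ω → ℝ) (βhat : ∀ N : ℕ, Ω → EuclideanSpace ℝ (Fin N))
    (hPCA : ∀ᵐ ω ∂P, ∀ᶠ N in atTop,
      IsPCA (sampleCov (fun t => R N t ω)) (σsqhat N ω) (βhat N ω))
    (δhat : ℕ → Ω → ℝ)
    (hδhat : ∀ᵐ ω ∂P, (∀ᶠ N in atTop, 0 < δhat N ω) ∧
      BddAbove (Set.range fun N => δhat N ω))
    -- the true and the estimated minimum variance portfolios
    (wstar : ∀ N : ℕ, Fin N → ℝ)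
    (hwstar : ∀ᶠ N in atTop, IsMinVar (factorCov (σ N ^ 2) (β N) (δ ^ 2)) (wstar N))
    (what : ∀ N : ℕ, Ω → Fin N → ℝ)
    (hwhat : ∀ᵐ ω ∂P, ∀ᶠ N in atTop,
      IsMinVar (factorCov (σsqhat N ω) (βhat N ω) (δhat N ω ^ 2)) (what N ω)) :
    ∀ᵐ ω ∂P,
      1 < psi c₁ δ (fun t => f t ω) ∧
      Tendsto (fun N => Real.cos (InnerProductGeometry.angle (βhat N ω) (β N))) atTop
        (𝓝 (psi c₁ δ fun t => f t ω)⁻¹) ∧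
      (∃ c : ℝ, 0 < c ∧ ∀ᶠ N in atTop,
        c ≤ trackingErrorSq (factorCov (σ N ^ 2) (β N) (δ ^ 2)) (wstar N) (what N ω)) ∧
      Tendsto (fun N => varForecastRatio (factorCov (σ N ^ 2) (β N) (δ ^ 2))
        (factorCov (σsqhat N ω) (βhat N ω) (δhat N ω ^ 2)) (what N ω)) atTop (𝓝 0) ∧
      Asymptotics.IsEquivalent atTop (fun N => errorTerm (β N) (βhat N ω))
        (fun N => ⟪β N, zVec N⟫ *
          ((1 - (psi c₁ δ fun t => f t ω) ^ (-2 : ℤ)) /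
            (1 - (psi c₁ δ fun t => f t ω) ^ (-2 : ℤ) * ⟪β N, zVec N⟫ ^ 2))) := by
  have hT0 : (0 : ℝ) < T := by exact_mod_cast hT
  obtain ⟨a, b₀, ha, hb₀, hγ⟩ := hβz
  have hd : 0 < δ ^ 2 := by positivity
  have hs : ∀ N, 0 ≤ σ N ^ 2 := fun N => sq_nonneg _
  have hκ₀ : 0 < (T * c₁)⁻¹ := by positivity
  have hκ : Tendsto (fun N : ℕ => σ N ^ 2 / N) atTop (𝓝 (T * c₁)⁻¹) := by
    have h := (hσc₁.const_mul (T : ℝ)).inv₀ (by positivity)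
    refine h.congr fun N => ?_
    rw [mul_div_assoc', mul_div_mul_left _ _ hT0.ne', inv_div]
  have hG : ∀ᵐ ω ∂P, ∀ s t, Tendsto (fun N : ℕ =>
      (⟪R N s ω, R N t ω⟫ - ⟪β N, R N s ω⟫ * ⟪β N, R N t ω⟫) / N) atTop
      (𝓝 (if s = t then δ ^ 2 else 0)) := by
    refine ae_all_iff.2 fun s => ae_all_iff.2 fun t => ?_
    by_cases hst : s = t
    · subst hst
      filter_upwards [ae_tendsto_specific_norm_sq hβ hs hd.le fun N => hRlaw N s] with ω hω
      simpa [← sq, real_inner_self_eq_norm_sq] using hω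
    · simpa [hst] using ae_tendsto_specific_inner hβ hs hd.le (fun N => hRlaw N s)
        (fun N => hRlaw N t) fun N => (hRindep N).indepFun hst
  -- The residual of `z` after projection on `β` is orthogonal to `β` with norm at most `1`, so it
  -- meets only specific noise.
  have hz : ∀ᵐ ω ∂P, ∀ t, Tendsto (fun N : ℕ =>
      ⟪zVec N - ⟪β N, zVec N⟫ • β N, R N t ω⟫ / √(N : ℝ)) atTop (𝓝 0) :=
    ae_all_iff.2 fun t => ae_tendsto_inner_specific hβ hs hd.le (fun N => hRlaw N t)
      (fun N hN => norm_sub_inner_smul_le (hβ N hN) (norm_zVec hN))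
      (fun N hN => inner_sub_inner_smul_self (hβ N hN))
  filter_upwards [hG, hz, ae_sum_sq_pos hT hflaw, ae_all_iff.2 hRf, hPCA, hδhat, hwhat]
    with ω hGω hzω hfω hxω hPCAω ⟨hδpos, C, hC⟩ hwhatω
  set ψ := psi c₁ δ fun t => f t ω with hψ
  have hψ1 : 1 < ψ := one_lt_psi hT hc₁ hδ hfω
  have hφ0 : 0 < ψ⁻¹ := by positivity
  have hφ1 : ψ⁻¹ ^ 2 < 1 := pow_lt_one₀ hφ0.le (inv_lt_one_of_one_lt₀ hψ1) two_ne_zero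
  obtain ⟨hμ, hp2, hhp⟩ := isPCA_limits hT hd hσ hκ hfω hxω hGω hzω hPCAω
  rw [← inv_psi_sq hT hc₁ hδ hfω, ← hψ] at hp2
  have hp := tendsto_of_sq_tendsto_of_oriented hφ0 ha hp2 hhp
    (hPCAω.mono fun N h => h.inner_nonneg) (hγ.mono fun N h => h.1)
  have hγ1 : ∀ᶠ N in atTop, |⟪β N, zVec N⟫| ≤ 1 := by
    filter_upwards [hγ] with N ⟨h1, h2⟩
    rw [abs_of_pos (ha.trans_le h1)]
    linarith
  have hh : Tendsto (fun N => ⟪βhat N ω, zVec N⟫ - ψ⁻¹ * ⟪β N, zVec N⟫) atTop (𝓝 0) := by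
    have h1 : Tendsto (fun N => ⟪β N, zVec N⟫ * (⟪β N, βhat N ω⟫ - ψ⁻¹)) atTop (𝓝 0) := by
      have h2 : Tendsto (fun N => ⟪β N, βhat N ω⟫ - ψ⁻¹) atTop (𝓝 0) := by
        simpa using hp.sub_const ψ⁻¹
      refine squeeze_zero_norm' ?_ (tendsto_zero_iff_norm_tendsto_zero.1 h2)
      filter_upwards [hγ1] with N hN
      rw [norm_mul]
      exact mul_le_of_le_one_left (norm_nonneg _) hN
    have h3 := hhp.add h1
    rw [add_zero] at h3
    refine h3.congr fun N => ?_
    ring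
  have hb : ∀ᶠ N in atTop, ‖βhat N ω‖ = 1 := hPCAω.mono fun N h => h.norm_eq_one
  have hμ' : Tendsto (fun N : ℕ => σsqhat N ω / N) atTop
      (𝓝 (((T * c₁)⁻¹ * ∑ t, f t ω ^ 2 + δ ^ 2) / T)) := by
    refine (hμ.div_const (T : ℝ)).congr fun N => ?_
    field_simp
  obtain ⟨htrack, hratio⟩ := portfolio_performance hβ ha hb₀ hγ hκ₀ hd hκ hwstar hφ1 hb hp hh
    (by positivity) hμ' (hδpos.mono fun N h => pow_pos h 2)
    (C := C ^ 2) (hδpos.mono fun N h => pow_le_pow_left₀ h.le (hC ⟨N, rfl⟩) 2) hwhatω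
  refine ⟨hψ1, ?_, htrack, hratio, ?_⟩
  · refine hp.congr' ?_
    filter_upwards [eventually_ge_atTop 1, hb] with N hN hbN
    rw [cos_angle_of_norm_eq_one hbN (hβ N hN), real_inner_comm]
  · have hψ2 : ψ ^ (-2 : ℤ) = ψ⁻¹ ^ 2 := by
      rw [zpow_neg, inv_pow]
      rfl
    have hlim := tendsto_exposure_sub hφ1 hγ1 hh hp (tendsto_const_nhds (x := (1 : ℝ)))
    simp only [hψ2]
    refine isEquivalent_of_tendsto_sub (c := a * (1 - ψ⁻¹ ^ 2)) (mul_pos ha (by linarith)) ?_ ?_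
    · refine hlim.congr' ?_
      filter_upwards [eventually_ge_atTop 1, hb] with N hN hbN
      rw [errorTerm_eq hN hbN, mul_div_assoc]
    · filter_upwards [hγ, hγ1] with N h1 h2
      rw [← mul_div_assoc]
      exact le_exposure_limit hφ1 ha h1.1 h2
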